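/- Let $\mathbb F$ be a Fréchet space and $M$ a smooth Fréchet manifold modelled on $\mathbb F$ (smoothness is meant in the Michal–Bastiani sense: all iterated directional derivatives $D^j\varphi(x)(h_1,\dots,h_j)$ exist and are jointly continuous in $(x,h_1,\dots,h_j)$). Let $\Pi:TM\to M$ be the tangent bundle, $\Pi_{TM}:T(TM)\to TM$ the double tangent bundle, $VTM=\ker T\Pi$ the vertical bundle, and $\mathrm{Inv}$ the canonical involution of $T(TM)$, $(x,v,u,w)\mapsto(x,u,v,w)$ in charts. Let $\mathcal C_2:VTM\to TM$ be the second projection of $VTM\simeq TM\times_M TM$, that is, $(x,v,0,w)\mapsto(x,w)$ in charts. A *spray* is a smooth map $S:TM\to T(TM)$ with $\Pi_{TM}\circ S=\mathrm{id}$, $T\Pi\circ S=\mathrm{id}$ and $S(sv)=(L_s)_*(s\,S(v))$ for all $s\in\mathbb R$, $v\in TM$, where $L_s(v)=sv$. In a chart $U$ it reads $(x,v)\mapsto(x,v,v,S_{U,2}(x,v))$; put $\mathbb B_U(x)=\tfrac12D_2^2S_{U,2}(x,0)$. A *connection map associated with $S$* is a smooth vector bundle morphism $K:T(TM)\to TM$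 over $\Pi$ which in every chart is $K_U(x,v,u,w)=(x,\,w-\mathbb B_U(x)(v,u))$. A *connection* on $TM$ is a smooth morphism $C:T(TM)\to VTM$ of vector bundles over $TM$ with $C|_{VTM}=\mathrm{id}$. It is *linear* if it is also linear on the fibres of $T\Pi:T(TM)\to TM$, and *linear symmetric* if moreover $\mathcal C_2\circ C\circ\mathrm{Inv}=\mathcal C_2\circ C$. Theorem. (1) Let $S$ be a spray on $M$. In every chart $U$, each $\mathbb B_U(x)$ is a symmetric bilinear map with $S_{U,2}(x,v)=\mathbb B_U(x)(v,v)$, and there is a unique linear symmetric connection $C$ on $TM$ that is given in every chart $U$ by $$C(x,u,v,w)=(x,u,0,\,w-\mathbb B_U(x)(v,u)).$$ (2) Conversely, for every linear symmetric connection $C$ on $TM$ there is a unique spray $S$ on $M$ such that $\mathcal C_2\circ C$ is the connection map associated with $S$. -/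

import Mathlib

open Filter Topology Set

namespace FrechetGeometry

section Calculus

/-- `d` is the derivative of `f` at `x` in the direction `h`. -/
def HasDirDeriv {E F : Type*} [AddCommGroup E] [Module ℝ E]
    [AddCommGroup F] [Module ℝ F] [TopologicalSpace F] (f : E → F) (x h : E) (d : F) : Prop :=
  Tendsto (fun t : ℝ => t⁻¹ • (f (x + t • h) - f x)) (𝓝[≠] 0) (𝓝 d)

/-- The derivative `D f (x) (h)` of `f` at `x` in the direction `h` (a junk value if the limit does
not exist). -/
noncomputable def dirDeriv {E F : Type*} [AddCommGroup E] [Module ℝ E]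
    [AddCommGroup F] [Module ℝ F] [TopologicalSpace F] (f : E → F) (x h : E) : F :=
  limUnder (𝓝[≠] (0 : ℝ)) fun t : ℝ => t⁻¹ • (f (x + t • h) - f x)

/-- The iterated directional derivative `D^j f (x) (h_1, …, h_j)`. -/
noncomputable def iterDirDeriv {E F : Type*} [AddCommGroup E] [Module ℝ E]
    [AddCommGroup F] [Module ℝ F] [TopologicalSpace F] (f : E → F) :
    (j : ℕ) → E → (Fin j → E) → F
  | 0, x, _ => f x
  | j + 1, x, h => dirDeriv (fun y => iterDirDeriv f j y (Fin.init h)) x (h (Fin.last j))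

/-- Smoothness in the sense of Michal and Bastiani on the (open) set `U`: all iterated directional
derivatives exist at the points of `U`, and the maps `D^j f : U × E^j → F` are continuous
(`j = 0` says that `f` itself is continuous on `U`). -/
def MBSmoothOn {E F : Type*} [AddCommGroup E] [Module ℝ E] [TopologicalSpace E]
    [AddCommGroup F] [Module ℝ F] [TopologicalSpace F] (f : E → F) (U : Set E) : Prop :=
  (∀ j : ℕ, ∀ x ∈ U, ∀ (h : Fin j → E) (k : E),
    ∃ d, HasDirDeriv (fun y => iterDirDeriv f j y h) x k d) ∧
  ∀ j : ℕ, ContinuousOn (fun p : E × (Fin j → E) => iterDirDeriv f j p.1 p.2) (U ×ˢ univ)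


set_option linter.unusedSectionVars false

variable {E F G Z : Type*}
  [AddCommGroup E] [Module ℝ E] [TopologicalSpace E] [IsTopologicalAddGroup E] [ContinuousSMul ℝ E]
  [AddCommGroup F] [Module ℝ F] [TopologicalSpace F] [IsTopologicalAddGroup F] [ContinuousSMul ℝ F]
  [LocallyConvexSpace ℝ F] [T2Space F]
  [AddCommGroup G] [Module ℝ G] [TopologicalSpace G] [IsTopologicalAddGroup G] [ContinuousSMul ℝ G]
  [LocallyConvexSpace ℝ G] [T2Space G]
  [TopologicalSpace Z]

theorem HasDirDeriv.eq {f : E → F} {x h : E} {d : F} (H : HasDirDeriv f x h d) :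
    dirDeriv f x h = d := Tendsto.limUnder_eq H

theorem HasDirDeriv.congr {f g : E → F} {U : Set E} (hU : IsOpen U) (hfg : ∀ y ∈ U, f y = g y)
    {x h : E} (hx : x ∈ U) {d : F} (H : HasDirDeriv f x h d) : HasDirDeriv g x h d := by
  have hc : Tendsto (fun t : ℝ => x + t • h) (𝓝[≠] 0) (𝓝 x) := by
    have : ContinuousAt (fun t : ℝ => x + t • h) 0 := by fun_prop
    have h2 := this.tendsto
    simp only [zero_smul, add_zero] at h2
    exact h2.mono_left nhdsWithin_le_nhds
  refine Tendsto.congr' ?_ H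
  filter_upwards [hc.eventually (hU.mem_nhds hx)] with t ht
  rw [hfg _ ht, hfg _ hx]

theorem HasDirDeriv.hasDerivAt (φ : StrongDual ℝ F) {f : E → F} {x h : E} {d : F} {u t : ℝ}
    (H : HasDirDeriv f (x + (u * t) • h) h d) :
    HasDerivAt (fun s : ℝ => φ (f (x + (s * t) • h))) (φ d * t) u := by
  have h1 : HasDerivAt (fun s : ℝ => φ (f (x + s • h))) (φ d) (u * t) := by
    rw [hasDerivAt_iff_tendsto_slope_zero]
    have := (φ.continuous.tendsto d).comp H
    refine this.congr fun r => ?_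
    simp [add_smul, add_assoc]
  exact h1.comp u (hasDerivAt_mul_const t)

theorem diffQuot_mem {V : Set F} (hV : Convex ℝ V) (hVo : IsOpen V) {f : E → F} {f' : ℝ → F}
    {x h : E} {t : ℝ} (ht : t ≠ 0)
    (H : ∀ s ∈ Icc (0 : ℝ) 1, HasDirDeriv f (x + (s * t) • h) h (f' s) ∧ f' s ∈ V) :
    t⁻¹ • (f (x + t • h) - f x) ∈ V := by
  by_contra hn
  obtain ⟨φ, hφ⟩ := geometric_hahn_banach_open_point hV hVo hn
  have hd := fun s hs => (H s hs).1.hasDerivAt φ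
  obtain ⟨c, hc, he⟩ := exists_hasDerivAt_eq_slope (fun s : ℝ => φ (f (x + (s * t) • h)))
    (fun s => φ (f' s) * t) zero_lt_one
    (fun s hs => (hd s hs).continuousAt.continuousWithinAt) (fun s hs => hd s (Ioo_subset_Icc_self hs))
  have h1 := hφ _ (H c (Ioo_subset_Icc_self hc)).2
  have h2 : φ (f' c) = t⁻¹ * (φ (f (x + t • h)) - φ (f x)) := by
    simp at he
    rw [← he]; field_simp
  simp [h2] at h1

theorem tendsto_diffQuot {f : E → F} {f' : E × Z → F} {d : Z → E} (hd : Continuous d) {x : E} {z : Z}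
    (H : ∀ᶠ p in 𝓝 (x, z), HasDirDeriv f p.1 (d p.2) (f' p)) (hc : ContinuousAt f' (x, z)) :
    Tendsto (fun p : ℝ × E × Z => p.1⁻¹ • (f (p.2.1 + p.1 • d p.2.2) - f p.2.1))
      (𝓝[≠] 0 ×ˢ 𝓝 (x, z)) (𝓝 (f' (x, z))) := by
  intro W hW
  have hW0 : (fun v => f' (x, z) + v) ⁻¹' W ∈ 𝓝 (0 : F) := by
    apply ContinuousAt.preimage_mem_nhds (by fun_prop)
    simpa using hW
  obtain ⟨V, ⟨h0, hVo, hVc⟩, hVW⟩ :=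
    (LocallyConvexSpace.convex_open_basis_zero ℝ F).mem_iff.1 hW0
  set V' : Set F := (fun v => -f' (x, z) + v) ⁻¹' V with hV'
  have hV'o : IsOpen V' := hVo.preimage (by fun_prop)
  have hV'c : Convex ℝ V' := hVc.translate_preimage_right _
  have hV'W : V' ⊆ W := by
    intro v hv
    have := hVW hv
    simpa using this
  have hV'm : f' (x, z) ∈ V' := by simpa [hV'] using h0
  set N : Set (E × Z) := {p | HasDirDeriv f p.1 (d p.2) (f' p) ∧ f' p ∈ V'} with hN
  have hE : N ∈ 𝓝 (x, z) := H.and (hc.eventually (hV'o.mem_nhds hV'm))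
  let m : (ℝ × E × Z) → ℝ → E × Z := fun q s => (q.2.1 + (s * q.1) • d q.2.2, q.2.2)
  have hm : Continuous (fun w : (ℝ × E × Z) × ℝ => m w.1 w.2) := by
    simp only [m]; fun_prop
  have hK : ∀ᶠ q in 𝓝 ((0 : ℝ), x, z), ∀ s ∈ Icc (0 : ℝ) 1, m q s ∈ N := by
    refine isCompact_Icc.eventually_forall_of_forall_eventually
      (P := fun q s => m q s ∈ N) fun s _ => ?_
    have h0 : m (0, x, z) s = (x, z) := by simp [m]
    exact hm.continuousAt.preimage_mem_nhds (by simpa only [h0] using hE)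
  rw [nhds_prod_eq] at hK
  have hK' := hK.filter_mono (Filter.prod_mono_left (𝓝 (x, z))
    (nhdsWithin_le_nhds (s := {(0 : ℝ)}ᶜ)))
  have hne : ∀ᶠ q in (𝓝[≠] (0 : ℝ)) ×ˢ 𝓝 (x, z), q.1 ≠ 0 :=
    Filter.tendsto_fst.eventually self_mem_nhdsWithin
  rw [mem_map]
  filter_upwards [hK', hne] with q hq hq0
  exact hV'W (diffQuot_mem hV'c hV'o hq0 hq)

theorem tendsto_add_smul (x h : E) : Tendsto (fun t : ℝ => x + t • h) (𝓝[≠] 0) (𝓝 x) := by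
  have : ContinuousAt (fun t : ℝ => x + t • h) 0 := by fun_prop
  have h2 := this.tendsto
  simp only [zero_smul, add_zero] at h2
  exact h2.mono_left nhdsWithin_le_nhds

theorem HasDirDeriv.add_dir {f : E → F} {f₁ : E → F} {x h k : E} {b : F}
    (H : ∀ᶠ y in 𝓝 x, HasDirDeriv f y h (f₁ y)) (hc : ContinuousAt f₁ x)
    (Hk : HasDirDeriv f x k b) : HasDirDeriv f x (h + k) (f₁ x + b) := by
  have h1 := tendsto_diffQuot (Z := Unit) (f := f) (f' := fun p => f₁ p.1) (d := fun _ => h)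
    (x := x) (z := ()) (by fun_prop) ((continuous_fst.tendsto (x, ())).eventually H)
    (ContinuousAt.comp (f := Prod.fst) (g := f₁) hc continuousAt_fst)
  have h2 : Tendsto (fun t : ℝ => (t, x + t • k, ())) (𝓝[≠] 0) (𝓝[≠] 0 ×ˢ 𝓝 (x, ())) := by
    refine tendsto_id.prodMk ?_
    rw [nhds_prod_eq]
    exact (tendsto_add_smul x k).prodMk (tendsto_const_nhds (x := ()))
  refine ((h1.comp h2).add Hk).congr fun t => ?_
  simp only [Function.comp_apply]
  rw [← smul_add]
  congr 1
  rw [smul_add, ← add_assoc, add_right_comm]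
  abel

theorem HasDirDeriv.zero_dir (f : E → F) (x : E) : HasDirDeriv f x 0 0 := by
  simp [HasDirDeriv]

theorem HasDirDeriv.smul_dir {f : E → F} {x h : E} {d : F} (H : HasDirDeriv f x h d) (c : ℝ) :
    HasDirDeriv f x (c • h) (c • d) := by
  rcases eq_or_ne c 0 with rfl | hc
  · simpa using HasDirDeriv.zero_dir f x
  have ht : Tendsto (fun t : ℝ => t * c) (𝓝[≠] 0) (𝓝[≠] 0) := by
    refine tendsto_nhdsWithin_iff.2 ⟨?_, ?_⟩
    · have : ContinuousAt (fun t : ℝ => t * c) 0 := by fun_prop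
      have h2 := this.tendsto
      simp only [zero_mul] at h2
      exact h2.mono_left nhdsWithin_le_nhds
    · filter_upwards [self_mem_nhdsWithin] with t ht
      exact mul_ne_zero ht hc
  refine ((Tendsto.comp H ht).const_smul c).congr fun t => ?_
  simp only [Function.comp_apply, smul_smul, mul_inv]
  congr 1
  field_simp

theorem HasDirDeriv.sum_dir {ι : Type*} {f : E → F} {f₁ : ι → E → F} {x : E} {d : ι → E}
    (s : Finset ι) (H : ∀ i ∈ s, ∀ᶠ y in 𝓝 x, HasDirDeriv f y (d i) (f₁ i y))
    (hc : ∀ i ∈ s, ContinuousAt (f₁ i) x) {k : E} {b : F} (Hk : HasDirDeriv f x k b) :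
    HasDirDeriv f x (∑ i ∈ s, d i + k) (∑ i ∈ s, f₁ i x + b) := by
  classical
  induction s using Finset.induction_on with
  | empty => simpa using Hk
  | insert a s ha ih =>
    rw [Finset.sum_insert ha, Finset.sum_insert ha, add_assoc, add_assoc]
    refine HasDirDeriv.add_dir (H a (Finset.mem_insert_self a s))
      (hc a (Finset.mem_insert_self a s)) (ih ?_ ?_)
    · exact fun i hi => H i (Finset.mem_insert_of_mem hi)
    · exact fun i hi => hc i (Finset.mem_insert_of_mem hi)

/-- The chain rule, with a continuously differentiable outer map. -/
theorem HasDirDeriv.comp {g : F → G} {g' : F × F → G} {f : E → F} {x h : E} {d : F}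
    (Hg : ∀ᶠ p in 𝓝 (f x, d), HasDirDeriv g p.1 p.2 (g' p)) (hc : ContinuousAt g' (f x, d))
    (Hf : HasDirDeriv f x h d) : HasDirDeriv (fun y => g (f y)) x h (g' (f x, d)) := by
  have h1 := tendsto_diffQuot (f := g) (f' := g') (d := id) continuous_id Hg hc
  have h2 : Tendsto (fun t : ℝ => (t, f x, t⁻¹ • (f (x + t • h) - f x))) (𝓝[≠] 0)
      (𝓝[≠] 0 ×ˢ 𝓝 (f x, d)) := by
    refine tendsto_id.prodMk ?_
    rw [nhds_prod_eq]
    exact (tendsto_const_nhds (x := f x)).prodMk Hf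
  refine (h1.comp h2).congr' ?_
  filter_upwards [self_mem_nhdsWithin] with t ht
  have ht0 : t ≠ 0 := ht
  simp [smul_smul, ht0]

/-! ### Recursive description of smoothness -/

/-- Recursive description of `C^n`-maps in the sense of Michal and Bastiani. -/
def MBRec.{u, v} : ℕ → ∀ {E : Type u} {F : Type v} [AddCommGroup E] [Module ℝ E]
    [TopologicalSpace E] [AddCommGroup F] [Module ℝ F] [TopologicalSpace F],
    (E → F) → Set E → Prop
  | 0, _, _, _, _, _, _, _, _, f, U => ContinuousOn f U
  | n + 1, E, F, _, _, _, _, _, _, f, U => ContinuousOn f U ∧ ∃ f' : E × E → F,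
      (∀ x ∈ U, ∀ h, HasDirDeriv f x h (f' (x, h))) ∧ MBRec n f' (U ×ˢ univ)

theorem MBRec.continuousOn {n : ℕ} {f : E → F} {U : Set E} (H : MBRec n f U) :
    ContinuousOn f U := by
  cases n with
  | zero => exact H
  | succ n => exact H.1

theorem MBRec.congr {n : ℕ} {f g : E → F} {U : Set E} (hU : IsOpen U) (hfg : ∀ y ∈ U, f y = g y)
    (H : MBRec n f U) : MBRec n g U := by
  have h0 : ContinuousOn g U := H.continuousOn.congr fun y hy => (hfg y hy).symm
  cases n with
  | zero => exact h0
  | succ n =>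
    obtain ⟨_, f', h1, h2⟩ := H
    exact ⟨h0, f', fun x hx h => (h1 x hx h).congr hU hfg hx, h2⟩

theorem MBRec.mono {n : ℕ} : ∀ {E : Type*} [AddCommGroup E] [Module ℝ E] [TopologicalSpace E]
    {f : E → F} {U V : Set E} (_ : V ⊆ U) (_ : MBRec n f U), MBRec n f V := by
  induction n with
  | zero => exact fun hV H => ContinuousOn.mono H hV
  | succ n ih =>
    rintro E _ _ _ f U V hV ⟨h0, f', h1, h2⟩
    exact ⟨h0.mono hV, f', fun x hx h => h1 x (hV hx) h, ih (prod_mono hV le_rfl) h2⟩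

theorem MBRec.comp_right {n : ℕ} : ∀ {E E' : Type*} [AddCommGroup E] [Module ℝ E]
    [TopologicalSpace E] [AddCommGroup E'] [Module ℝ E'] [TopologicalSpace E']
    {f : E → F} {U : Set E} (A : E' →L[ℝ] E) (_ : MBRec n f U),
    MBRec n (fun x => f (A x)) (A ⁻¹' U) := by
  induction n with
  | zero => exact fun A H => ContinuousOn.comp H A.continuous.continuousOn fun x hx => hx
  | succ n ih =>
    rintro E E' _ _ _ _ _ _ f U A ⟨h0, f', h1, h2⟩
    refine ⟨h0.comp A.continuous.continuousOn fun x hx => hx, fun p => f' (A p.1, A p.2),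
      fun x hx h => ?_, ?_⟩
    · simpa [HasDirDeriv] using h1 (A x) hx (A h)
    · refine MBRec.mono ?_ (ih (A.prodMap A) h2)
      exact fun p hp => ⟨hp.1, trivial⟩

theorem MBRec.comp_left {n : ℕ} (L : F →L[ℝ] G) : ∀ {E : Type*} [AddCommGroup E] [Module ℝ E]
    [TopologicalSpace E] {f : E → F} {U : Set E} (_ : MBRec n f U),
    MBRec n (fun x => L (f x)) U := by
  induction n with
  | zero => exact fun H => L.continuous.comp_continuousOn H
  | succ n ih =>
    rintro E _ _ _ f U ⟨h0, f', h1, h2⟩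
    refine ⟨L.continuous.comp_continuousOn h0, fun p => L (f' p), fun x hx h => ?_, ih h2⟩
    refine ((L.continuous.tendsto _).comp (h1 x hx h)).congr fun t => ?_
    simp

theorem MBRec.prodMk {n : ℕ} : ∀ {E : Type*} [AddCommGroup E] [Module ℝ E]
    [TopologicalSpace E] {f : E → F} {g : E → G} {U : Set E} (_ : MBRec n f U)
    (_ : MBRec n g U), MBRec n (fun x => (f x, g x)) U := by
  induction n with
  | zero => exact fun H H' => ContinuousOn.prodMk H H'
  | succ n ih =>
    rintro E _ _ _ f g U ⟨h0, f', h1, h2⟩ ⟨k0, g', k1, k2⟩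
    refine ⟨h0.prodMk k0, fun p => (f' p, g' p), fun x hx h => ?_, ih h2 k2⟩
    exact (h1 x hx h).prodMk_nhds (k1 x hx h)

theorem MBRec.sum {n : ℕ} {ι : Type*} (s : Finset ι) : ∀ {E : Type*} [AddCommGroup E] [Module ℝ E]
    [TopologicalSpace E] {f : ι → E → F} {U : Set E}
    (_ : ∀ i, MBRec n (f i) U), MBRec n (fun x => ∑ i ∈ s, f i x) U := by
  induction n with
  | zero => exact fun H => continuousOn_finsetSum _ fun i _ => H i
  | succ n ih =>
    rintro E _ _ _ f U H
    choose h0 f' h1 h2 using H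
    refine ⟨continuousOn_finsetSum _ fun i _ => h0 i, fun p => ∑ i ∈ s, f' i p,
      fun x hx h => ?_, ih h2⟩
    refine (tendsto_finsetSum s fun i _ => h1 i x hx h).congr fun t => ?_
    rw [← Finset.smul_sum, Finset.sum_sub_distrib]

theorem MBRec.add {n : ℕ} {f g : E → F} {U : Set E} (H : MBRec n f U) (H' : MBRec n g U) :
    MBRec n (fun x => f x + g x) U := by
  have := MBRec.comp_left (ContinuousLinearMap.fst ℝ F F + ContinuousLinearMap.snd ℝ F F)
    (H.prodMk H')
  simpa using this

/-! ### Iterated directional derivatives -/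

theorem MBSmoothOn.hasDirDeriv_iter {f : E → F} {U : Set E} (H : MBSmoothOn f U) (j : ℕ) {x : E}
    (hx : x ∈ U) (h : Fin j → E) (k : E) :
    HasDirDeriv (fun y => iterDirDeriv f j y h) x k (iterDirDeriv f (j + 1) x (Fin.snoc h k)) := by
  obtain ⟨d, hd⟩ := H.1 j x hx h k
  have : iterDirDeriv f (j + 1) x (Fin.snoc h k) = d := by
    simpa [iterDirDeriv] using hd.eq
  rwa [this]

theorem MBSmoothOn.continuousOn_dir {f : E → F} {U : Set E} (H : MBSmoothOn f U) (j : ℕ)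
    (h : Fin j → E) : ContinuousOn (fun p : E × E =>
      iterDirDeriv f (j + 1) p.1 (Fin.snoc h p.2)) (U ×ˢ univ) := by
  refine (H.2 (j + 1)).comp (f := fun p : E × E => (p.1, (Fin.snoc h p.2 : Fin (j + 1) → E))) ?_ ?_
  · refine Continuous.continuousOn (continuous_fst.prodMk ?_)
    refine continuous_pi fun i => ?_
    refine Fin.lastCases ?_ (fun i => ?_) i
    · simpa using continuous_snd
    · simpa using continuous_const
  · exact fun p hp => ⟨hp.1, trivial⟩

theorem HasDirDeriv.additive {f : E → F} {f' : E × E → F} {U : Set E} (hU : IsOpen U)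
    (h1 : ∀ x ∈ U, ∀ h, HasDirDeriv f x h (f' (x, h))) (h2 : ContinuousOn f' (U ×ˢ univ))
    {x : E} (hx : x ∈ U) (h k : E) (c : ℝ) : f' (x, h + c • k) = f' (x, h) + c • f' (x, k) := by
  have hc : ContinuousAt (fun y => f' (y, h)) x := by
    have : ContinuousAt f' (x, h) :=
      h2.continuousAt ((hU.prod isOpen_univ).mem_nhds ⟨hx, trivial⟩)
    exact ContinuousAt.comp (f := fun y => (y, h)) (g := f') this (by fun_prop)
  have h3 := HasDirDeriv.add_dir (f₁ := fun y => f' (y, h))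
    (by filter_upwards [hU.mem_nhds hx] with y hy using h1 y hy h) hc ((h1 x hx k).smul_dir c)
  exact tendsto_nhds_unique (h1 x hx _) h3

theorem MBSmoothOn.iter_linear {f : E → F} {U : Set E} (hU : IsOpen U) (H : MBSmoothOn f U) (j : ℕ) :
    ∀ {x : E} (_ : x ∈ U) (h : Fin j → E) (i : Fin j) (a b : E) (c : ℝ),
    iterDirDeriv f j x (Function.update h i (a + c • b)) =
      iterDirDeriv f j x (Function.update h i a) +
        c • iterDirDeriv f j x (Function.update h i b) := by
  induction j with
  | zero => exact fun _ _ i => i.elim0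
  | succ j ih =>
    intro x hx h i
    refine Fin.lastCases (fun a b c => ?_) (fun i a b c => ?_) i
    · have h3 := HasDirDeriv.additive hU (f := fun y => iterDirDeriv f j y (Fin.init h))
        (f' := fun p => iterDirDeriv f (j + 1) p.1 (Fin.snoc (Fin.init h) p.2))
        (fun x hx k => H.hasDirDeriv_iter j hx _ k) (H.continuousOn_dir j _) hx a b c
      have h4 : ∀ k, Function.update h (Fin.last j) k = Fin.snoc (Fin.init h) k := by
        intro k
        conv_lhs => rw [← Fin.snoc_init_self h, Fin.update_snoc_last]
      simpa only [h4] using h3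
    · have h4 : ∀ k, Function.update h i.castSucc k =
          Fin.snoc (Function.update (Fin.init h) i k) (h (Fin.last j)) := by
        intro k
        conv_lhs => rw [← Fin.snoc_init_self h]
        rw [Fin.snoc_update]
      simp only [h4]
      have ha := H.hasDirDeriv_iter j hx (Function.update (Fin.init h) i a) (h (Fin.last j))
      have hb := H.hasDirDeriv_iter j hx (Function.update (Fin.init h) i b) (h (Fin.last j))
      have hab := H.hasDirDeriv_iter j hx (Function.update (Fin.init h) i (a + c • b))
        (h (Fin.last j))
      refine tendsto_nhds_unique hab (((ha.add (hb.const_smul c)).congr' ?_))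
      filter_upwards [(tendsto_add_smul x (h (Fin.last j))).eventually (hU.mem_nhds hx)] with t ht
      rw [ih ht, ih hx, smul_comm c, ← smul_add]
      congr 1
      module

theorem MBSmoothOn.mbRec_iter {f : E → F} {U : Set E} (hU : IsOpen U) (H : MBSmoothOn f U) (n : ℕ) :
    ∀ j : ℕ, MBRec n (fun p : E × (Fin j → E) => iterDirDeriv f j p.1 p.2) (U ×ˢ univ) := by
  have hUj : ∀ j, IsOpen (U ×ˢ (univ : Set (Fin j → E))) := fun j => hU.prod isOpen_univ
  induction n with
  | zero => exact fun j => H.2 j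
  | succ n ih =>
    intro j
    refine ⟨H.2 j, fun q => ∑ i : Fin j, iterDirDeriv f j q.1.1 (Function.update q.1.2 i (q.2.2 i)) +
      iterDirDeriv f (j + 1) q.1.1 (Fin.snoc q.1.2 q.2.1), ?_, ?_⟩
    · rintro ⟨x, h⟩ ⟨hx, -⟩ ⟨k, l⟩
      have h1 : HasDirDeriv (fun p : E × (Fin j → E) => iterDirDeriv f j p.1 p.2) (x, h)
          (k, 0) (iterDirDeriv f (j + 1) x (Fin.snoc h k)) := by
        simpa [HasDirDeriv] using H.hasDirDeriv_iter j hx h k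
      have h2 := HasDirDeriv.sum_dir (f := fun p : E × (Fin j → E) => iterDirDeriv f j p.1 p.2)
        (x := (x, h)) (d := fun i => ((0 : E), (Pi.single i (l i) : Fin j → E)))
        (f₁ := fun i p => iterDirDeriv f j p.1 (Function.update p.2 i (l i))) Finset.univ
        (fun i _ => ?_) (fun i _ => ?_) h1
      · have h3 : ∑ i : Fin j, ((0 : E), (Pi.single i (l i) : Fin j → E)) + (k, 0) = (k, l) := by
          ext i
          · simp [Prod.fst_sum]
          · simp [Prod.snd_sum, Finset.univ_sum_single]
        rw [h3] at h2
        exact h2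
      · filter_upwards [(hUj j).mem_nhds (show (x, h) ∈ _ from ⟨hx, trivial⟩)] with p hp
        refine tendsto_const_nhds.congr' ?_
        filter_upwards [self_mem_nhdsWithin] with t ht
        have ht0 : t ≠ 0 := ht
        have h4 : p.2 + t • (Pi.single i (l i) : Fin j → E) =
            Function.update p.2 i (p.2 i + t • l i) := by
          ext m
          by_cases hm : m = i
          · subst hm; simp
          · simp [hm]
        simp only [Prod.fst_add, Prod.snd_add, Prod.smul_fst, Prod.smul_snd, smul_zero, add_zero,
          h4]
        rw [H.iter_linear hU j hp.1]
        simp [smul_smul, ht0]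
      · refine ((H.2 j).continuousAt ((hUj j).mem_nhds ?_)).comp
          (f := fun p : E × (Fin j → E) => (p.1, Function.update p.2 i (l i))) ?_
        · exact ⟨hx, trivial⟩
        · fun_prop
    · refine MBRec.add (MBRec.sum _ fun i => ?_) ?_
      · let A : (E × (Fin j → E)) × (E × (Fin j → E)) →L[ℝ] E × (Fin j → E) :=
          { toFun := fun q => (q.1.1, Function.update q.1.2 i (q.2.2 i))
            map_add' := fun q r => by
              ext m
              · simp
              · by_cases hm : m = i
                · subst hm; simp
                · simp [hm]
            map_smul' := fun c q => by
              ext m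
              · simp
              · by_cases hm : m = i
                · subst hm; simp
                · simp [hm]
            cont := by fun_prop }
        refine MBRec.mono ?_ ((ih j).comp_right A)
        exact fun q hq => ⟨hq.1.1, trivial⟩
      · let A : (E × (Fin j → E)) × (E × (Fin j → E)) →L[ℝ] E × (Fin (j + 1) → E) :=
          { toFun := fun q => (q.1.1, Fin.snoc q.1.2 q.2.1)
            map_add' := fun q r => by
              ext m
              · simp
              · refine Fin.lastCases ?_ (fun m => ?_) m <;> simp
            map_smul' := fun c q => by
              ext m
              · simp
              · refine Fin.lastCases ?_ (fun m => ?_) m <;> simp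
            cont := by
              refine (by fun_prop : Continuous _).prodMk (continuous_pi fun m => ?_)
              refine Fin.lastCases ?_ (fun m => ?_) m
              · simp; fun_prop
              · simp; fun_prop }
        refine MBRec.mono ?_ ((ih (j + 1)).comp_right A)
        exact fun q hq => ⟨hq.1.1, trivial⟩

theorem mbSmoothOn_of_mbRec {f : E → F} {U : Set E} (hU : IsOpen U) (H : ∀ n, MBRec n f U) :
    MBSmoothOn f U := by
  have key : ∀ j : ℕ, ∀ n,
      MBRec n (fun p : E × (Fin j → E) => iterDirDeriv f j p.1 p.2) (U ×ˢ univ) := by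
    intro j
    induction j with
    | zero =>
      exact fun n => ((H n).comp_right (ContinuousLinearMap.fst ℝ E (Fin 0 → E))).mono
        fun p hp => hp.1
    | succ j ih =>
      intro n
      obtain ⟨-, g, h1, h2⟩ := ih (n + 1)
      let A : E × (Fin (j + 1) → E) →L[ℝ] (E × (Fin j → E)) × (E × (Fin j → E)) :=
        { toFun := fun q => ((q.1, Fin.init q.2), (q.2 (Fin.last j), 0))
          map_add' := fun q r => by ext m <;> simp [Fin.init]
          map_smul' := fun c q => by ext m <;> simp [Fin.init]
          cont := by unfold Fin.init; fun_prop }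
      refine ((h2.comp_right A).mono ?_).congr (hU.prod isOpen_univ) (U := U ×ˢ univ) fun p hp => ?_
      · exact fun q hq => ⟨⟨hq.1, trivial⟩, trivial⟩
      · have h3 := h1 (p.1, Fin.init p.2) ⟨hp.1, trivial⟩ (p.2 (Fin.last j), 0)
        have h4 : HasDirDeriv (fun y => iterDirDeriv f j y (Fin.init p.2)) p.1 (p.2 (Fin.last j))
            (g ((p.1, Fin.init p.2), (p.2 (Fin.last j), 0))) := by
          simpa [HasDirDeriv] using h3
        exact h4.eq.symm
  refine ⟨fun j x hx h k => ?_, fun j => key j 0⟩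
  obtain ⟨-, g, h1, h2⟩ := key j 1
  refine ⟨g ((x, h), (k, 0)), ?_⟩
  simpa [HasDirDeriv] using h1 (x, h) ⟨hx, trivial⟩ (k, 0)

theorem MBSmoothOn.hasDirDeriv {f : E → F} {U : Set E} (H : MBSmoothOn f U) {x : E} (hx : x ∈ U)
    (h : E) : HasDirDeriv f x h (dirDeriv f x h) := by
  obtain ⟨d, hd⟩ := H.1 0 x hx Fin.elim0 h
  have hd' : HasDirDeriv f x h d := hd
  rwa [hd'.eq]

/-- The tangent map `(x, v) ↦ (f x, D f (x) (v))` of a smooth map is smooth. -/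
theorem MBSmoothOn.tangent {f : E → F} {U : Set E} (hU : IsOpen U) (H : MBSmoothOn f U) :
    MBSmoothOn (fun p : E × E => (f p.1, dirDeriv f p.1 p.2)) (U ×ˢ univ) := by
  refine mbSmoothOn_of_mbRec (hU.prod isOpen_univ) fun n => MBRec.prodMk ?_ ?_
  · let A : E × E →L[ℝ] E × (Fin 0 → E) := (ContinuousLinearMap.fst ℝ E E).prod 0
    refine MBRec.mono ?_ ((H.mbRec_iter hU n 0).comp_right A)
    exact fun p hp => ⟨hp.1, trivial⟩
  · let A : E × E →L[ℝ] E × (Fin 1 → E) := (ContinuousLinearMap.fst ℝ E E).prod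
      (ContinuousLinearMap.pi fun _ => ContinuousLinearMap.snd ℝ E E)
    refine MBRec.mono ?_ ((H.mbRec_iter hU n 1).comp_right A)
    exact fun p hp => ⟨hp.1, trivial⟩

theorem MBSmoothOn.continuousOn {f : E → F} {U : Set E} (H : MBSmoothOn f U) :
    ContinuousOn f U :=
  (H.2 0).comp (f := fun x => (x, Fin.elim0)) (by fun_prop) fun _ hx => ⟨hx, trivial⟩

theorem MBSmoothOn.congr {f g : E → F} {U : Set E} (hU : IsOpen U) (hfg : ∀ y ∈ U, f y = g y)
    (H : MBSmoothOn f U) : MBSmoothOn g U := by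
  refine mbSmoothOn_of_mbRec hU fun n => ?_
  have h := (H.mbRec_iter hU n 0).comp_right
    ((ContinuousLinearMap.id ℝ E).prod (0 : E →L[ℝ] (Fin 0 → E)))
  have h' : MBRec n f U := by
    refine MBRec.mono ?_ h
    exact fun p hp => ⟨hp, trivial⟩
  exact h'.congr hU hfg

theorem MBSmoothOn.comp_hasDirDeriv {g : F → G} {V : Set F} (hV : IsOpen V) (H : MBSmoothOn g V)
    {f : E → F} {x h : E} {d : F} (hx : f x ∈ V) (Hf : HasDirDeriv f x h d) :
    HasDirDeriv (fun y => g (f y)) x h (dirDeriv g (f x) d) := by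
  have hO : IsOpen (V ×ˢ (univ : Set F)) := hV.prod isOpen_univ
  have hm : (f x, d) ∈ V ×ˢ (univ : Set F) := ⟨hx, trivial⟩
  refine HasDirDeriv.comp (g' := fun p => dirDeriv g p.1 p.2) ?_ ?_ Hf
  · filter_upwards [hO.mem_nhds hm] with p hp using H.hasDirDeriv hp.1 p.2
  · exact ((H.tangent hV).continuousOn.continuousAt (hO.mem_nhds hm)).snd

theorem dirDeriv_of_eqOn_id {f : E → E} {U : Set E} [LocallyConvexSpace ℝ E] [T2Space E]
    (hU : IsOpen U) (hf : ∀ y ∈ U, f y = y) {x : E} (hx : x ∈ U) (v : E) : dirDeriv f x v = v := by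
  have h : HasDirDeriv (id : E → E) x v v := by
    refine tendsto_const_nhds.congr' ?_
    filter_upwards [self_mem_nhdsWithin] with t ht
    have ht0 : t ≠ 0 := ht
    simp [smul_smul, ht0]
  exact (h.congr hU (fun y hy => (hf y hy).symm) hx).eq

end Calculus

/-! ### Manifolds modelled on a locally convex space and their tangent bundles -/

section Manifold

set_option linter.unusedSectionVars false

/-- `M`, with the given atlas of charts in the locally convex space `E`, is a smooth manifold: the
transition maps are smooth in the sense of Michal and Bastiani. -/
class SmoothManifold (E M : Type*) [AddCommGroup E] [Module ℝ E] [TopologicalSpace E]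
    [TopologicalSpace M] [ChartedSpace E M] : Prop where
  smooth_transition : ∀ e ∈ atlas E M, ∀ e' ∈ atlas E M,
    MBSmoothOn (e' ∘ e.symm) (e.symm.trans e').source

/-- Smooth maps between manifolds (modelled on `E` and on `E'`). -/
def SmoothMap (E E' : Type*) {M N : Type*}
    [AddCommGroup E] [Module ℝ E] [TopologicalSpace E] [TopologicalSpace M] [ChartedSpace E M]
    [AddCommGroup E'] [Module ℝ E'] [TopologicalSpace E'] [TopologicalSpace N] [ChartedSpace E' N]
    (f : M → N) : Prop :=
  Continuous f ∧ ∀ e ∈ atlas E M, ∀ e' ∈ atlas E' N,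
    MBSmoothOn (e' ∘ f ∘ e.symm) (e.target ∩ e.symm ⁻¹' (f ⁻¹' e'.source))

/-- The tangent bundle of a manifold `M` modelled on `E`. A tangent vector is given by its base
point `pt` and by its coordinates `vec` in the preferred chart `chartAt E pt`; the coordinates in
the other charts come from the derivatives of the transition maps, see `tangentPartialEquiv`. -/
@[ext]
structure TangentBdl (E M : Type*) where
  /-- the base point -/
  pt : M
  /-- the coordinates in the preferred chart at the base point -/
  vec : E

variable {E M : Type*} [AddCommGroup E] [Module ℝ E] [TopologicalSpace E]
  [IsTopologicalAddGroup E] [ContinuousSMul ℝ E] [LocallyConvexSpace ℝ E] [T2Space E]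
  [TopologicalSpace M] [ChartedSpace E M] [SmoothManifold E M]

theorem isOpen_transition_source (e e' : OpenPartialHomeomorph M E) :
    IsOpen (e.symm.trans e').source := (e.symm.trans e').open_source

theorem transition_cocycle (e₁ e₂ e₃ : atlas E M) {x : M} (h₁ : x ∈ e₁.1.source)
    (h₂ : x ∈ e₂.1.source) (h₃ : x ∈ e₃.1.source) (v : E) :
    dirDeriv (e₃.1 ∘ e₂.1.symm) (e₂.1 x) (dirDeriv (e₂.1 ∘ e₁.1.symm) (e₁.1 x) v) =
      dirDeriv (e₃.1 ∘ e₁.1.symm) (e₁.1 x) v := by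
  have H₁₂ := SmoothManifold.smooth_transition e₁.1 e₁.2 e₂.1 e₂.2
  have H₂₃ := SmoothManifold.smooth_transition e₂.1 e₂.2 e₃.1 e₃.2
  have hx : e₁.1 x ∈ (e₁.1.symm.trans e₂.1).source := by simp [h₁, h₂]
  have hx' : (e₂.1 ∘ e₁.1.symm) (e₁.1 x) ∈ (e₂.1.symm.trans e₃.1).source := by simp [h₁, h₂, h₃]
  have h := H₂₃.comp_hasDirDeriv (isOpen_transition_source _ _) hx' (H₁₂.hasDirDeriv hx v)
  have h' := (h.congr (isOpen_transition_source e₁.1 e₂.1) (g := e₃.1 ∘ e₁.1.symm) ?_ hx).eq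
  · rw [h']
    simp [h₁]
  · intro y hy
    simp only [OpenPartialHomeomorph.trans_source, OpenPartialHomeomorph.symm_source, mem_inter_iff,
      mem_preimage] at hy
    simp [hy.2]

theorem transition_self (e : atlas E M) {x : M} (h : x ∈ e.1.source) (v : E) :
    dirDeriv (e.1 ∘ e.1.symm) (e.1 x) v = v :=
  dirDeriv_of_eqOn_id e.1.open_target (fun _ hy => e.1.right_inv hy) (e.1.map_source h) v

/-- The chart of the tangent bundle induced by a chart `e` of `M`: a tangent vector at `x`, with
coordinates `v` in the preferred chart `c` at `x`, goes to `(e x, D (e ∘ c⁻¹) (c x) (v))`. -/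
noncomputable def tangentPartialEquiv (e : atlas E M) : PartialEquiv (TangentBdl E M) (E × E) where
  toFun p := (e.1 p.pt, dirDeriv (e.1 ∘ (chartAt E p.pt).symm) (chartAt E p.pt p.pt) p.vec)
  invFun q := ⟨e.1.symm q.1, dirDeriv (chartAt E (e.1.symm q.1) ∘ e.1.symm) q.1 q.2⟩
  source := {p | p.pt ∈ e.1.source}
  target := e.1.target ×ˢ univ
  map_source' p hp := ⟨e.1.map_source hp, trivial⟩
  map_target' q hq := e.1.map_target hq.1
  left_inv' p hp := by
    have hp' : p.pt ∈ e.1.source := hp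
    have h := transition_cocycle ⟨_, chart_mem_atlas E p.pt⟩ e ⟨_, chart_mem_atlas E p.pt⟩
      (mem_chart_source E p.pt) hp' (mem_chart_source E p.pt) p.vec
    have h' := transition_self ⟨_, chart_mem_atlas E p.pt⟩ (mem_chart_source E p.pt) p.vec
    ext
    · exact e.1.left_inv hp'
    · simp only [e.1.left_inv hp']
      exact h.trans h'
  right_inv' q hq := by
    have hx := e.1.map_target hq.1
    have h := transition_cocycle e ⟨_, chart_mem_atlas E (e.1.symm q.1)⟩ e hx
      (mem_chart_source E (e.1.symm q.1)) hx q.2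
    have h' := transition_self e hx q.2
    rw [e.1.right_inv hq.1] at h h'
    ext
    · exact e.1.right_inv hq.1
    · exact h.trans h'

theorem tangentPartialEquiv_transition_source (e e' : atlas E M) :
    ((tangentPartialEquiv e).symm.trans (tangentPartialEquiv e')).source =
      (e.1.symm.trans e'.1).source ×ˢ univ := by
  ext q
  exact ⟨fun h => ⟨⟨h.1.1, h.2⟩, trivial⟩, fun h => ⟨⟨h.1.1, trivial⟩, h.1.2⟩⟩

theorem tangentPartialEquiv_transition (e e' : atlas E M) {q : E × E}
    (hq : q ∈ (e.1.symm.trans e'.1).source ×ˢ (univ : Set E)) :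
    tangentPartialEquiv e' ((tangentPartialEquiv e).symm q) =
      ((e'.1 ∘ e.1.symm) q.1, dirDeriv (e'.1 ∘ e.1.symm) q.1 q.2) := by
  have h1 : q.1 ∈ e.1.target ∧ e.1.symm q.1 ∈ e'.1.source := by simpa using hq.1
  have h := transition_cocycle e ⟨_, chart_mem_atlas E (e.1.symm q.1)⟩ e' (e.1.map_target h1.1)
      (mem_chart_source E (e.1.symm q.1)) h1.2 q.2
  rw [e.1.right_inv h1.1] at h
  ext
  · rfl
  · exact h

theorem smooth_tangent_transition (e e' : atlas E M) :
    MBSmoothOn (tangentPartialEquiv e' ∘ (tangentPartialEquiv e).symm)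
      ((e.1.symm.trans e'.1).source ×ˢ univ) :=
  ((SmoothManifold.smooth_transition e.1 e.2 e'.1 e'.2).tangent
    (isOpen_transition_source e.1 e'.1)).congr ((isOpen_transition_source e.1 e'.1).prod isOpen_univ)
    fun _ hq => (tangentPartialEquiv_transition e e' hq).symm

/-- The charts of the tangent bundle. -/
noncomputable def tangentCore (E M : Type*) [AddCommGroup E] [Module ℝ E] [TopologicalSpace E]
    [IsTopologicalAddGroup E] [ContinuousSMul ℝ E] [LocallyConvexSpace ℝ E] [T2Space E]
    [TopologicalSpace M] [ChartedSpace E M] [SmoothManifold E M] :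
    ChartedSpaceCore (E × E) (TangentBdl E M) where
  atlas := range tangentPartialEquiv
  chartAt p := tangentPartialEquiv ⟨chartAt E p.pt, chart_mem_atlas E p.pt⟩
  mem_chart_source p := mem_chart_source E p.pt
  chart_mem_atlas p := mem_range_self _
  open_source := by
    rintro _ _ ⟨e, rfl⟩ ⟨e', rfl⟩
    rw [tangentPartialEquiv_transition_source]
    exact (isOpen_transition_source e.1 e'.1).prod isOpen_univ
  continuousOn_toFun := by
    rintro _ _ ⟨e, rfl⟩ ⟨e', rfl⟩
    rw [tangentPartialEquiv_transition_source]
    exact (smooth_tangent_transition e e').continuousOn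

noncomputable instance : TopologicalSpace (TangentBdl E M) := (tangentCore E M).toTopologicalSpace

noncomputable instance : ChartedSpace (E × E) (TangentBdl E M) := (tangentCore E M).toChartedSpace

/-- The chart `T e` of the tangent bundle induced by the chart `e` of the manifold. -/
noncomputable def tangentChart (e : atlas E M) : atlas (E × E) (TangentBdl E M) :=
  ⟨(tangentCore E M).openPartialHomeomorph (tangentPartialEquiv e) (mem_range_self e), by
    refine mem_iUnion.2 ⟨tangentPartialEquiv e, mem_iUnion.2 ⟨mem_range_self e, rfl⟩⟩⟩

theorem exists_eq_tangentChart {e : OpenPartialHomeomorph (TangentBdl E M) (E × E)}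
    (he : e ∈ atlas (E × E) (TangentBdl E M)) : ∃ e' : atlas E M, e = (tangentChart e').1 := by
  obtain ⟨_, h⟩ := mem_iUnion.1 he
  obtain ⟨⟨e', rfl⟩, h⟩ := mem_iUnion.1 h
  exact ⟨e', h⟩

/-- The tangent bundle is a smooth manifold. -/
instance : SmoothManifold (E × E) (TangentBdl E M) where
  smooth_transition := by
    intro _ he _ he'
    obtain ⟨e, rfl⟩ := exists_eq_tangentChart he
    obtain ⟨e', rfl⟩ := exists_eq_tangentChart he'
    have h := smooth_tangent_transition e e'
    rw [← tangentPartialEquiv_transition_source] at h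
    exact h

/-- The projection `Π_M : TM → M`. -/
def tangentProj (E : Type*) {M : Type*} (p : TangentBdl E M) : M := p.pt

/-- Scalar multiplication in the fibres of the tangent bundle. -/
instance : SMul ℝ (TangentBdl E M) := ⟨fun s p => ⟨p.pt, s • p.vec⟩⟩

/-- The tangent map `T f : TM → TN` of a map `f : M → N`. -/
noncomputable def tangentMapOf (E E' : Type*) {M N : Type*}
    [AddCommGroup E] [Module ℝ E] [TopologicalSpace E] [TopologicalSpace M] [ChartedSpace E M]
    [AddCommGroup E'] [Module ℝ E'] [TopologicalSpace E'] [TopologicalSpace N] [ChartedSpace E' N]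
    (f : M → N) (p : TangentBdl E M) : TangentBdl E' N :=
  ⟨f p.pt, dirDeriv (chartAt E' (f p.pt) ∘ f ∘ (chartAt E p.pt).symm) (chartAt E p.pt p.pt) p.vec⟩

/-- The double tangent bundle `T(TM)`. A point `ξ = ⟨⟨x, v⟩, (u, w)⟩` has the coordinates
`(x, v, u, w)` in the chart that the preferred chart at `x` induces on `T(TM)`. -/
abbrev TangentBdl₂ (E M : Type*) := TangentBdl (E × E) (TangentBdl E M)

/-- The chart `T(T e)` of `T(TM)` induced by a chart `e` of `M`; its values are written
`((x, v), (u, w))`. -/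
noncomputable def tangentChart₂ (e : atlas E M) : atlas ((E × E) × (E × E)) (TangentBdl₂ E M) :=
  tangentChart (tangentChart e)

/-- The map `T Π_M : T(TM) → TM`. -/
noncomputable def tangentMapProj (ξ : TangentBdl₂ E M) : TangentBdl E M :=
  tangentMapOf (E × E) E (tangentProj E) ξ

/-- A spray: a smooth vector field `S` on `TM`, of second order (`T Π_M ∘ S = id`), such that
`S (s v) = (L_s)_* (s S (v))`, where `L_s : TM → TM` is the multiplication by `s`. -/
structure IsSpray (S : TangentBdl E M → TangentBdl₂ E M) : Prop where
  smooth : SmoothMap (E × E) ((E × E) × (E × E)) S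
  isSection : ∀ v, tangentProj (E × E) (S v) = v
  second_order : ∀ v, tangentMapProj (S v) = v
  homogeneous : ∀ (s : ℝ) (v : TangentBdl E M),
    S (s • v) = tangentMapOf (E × E) (E × E) (fun p : TangentBdl E M => s • p) (s • S v)

/-- The second component of the local representative
`(x, v) ↦ (x, v, S_{U,1} (x, v), S_{U,2} (x, v))` of `S` in the chart `e : U → E`. -/
noncomputable def sprayCoeff (S : TangentBdl E M → TangentBdl₂ E M) (e : atlas E M) (x v : E) : E :=
  ((tangentChart₂ e).1 (S ((tangentChart e).1.symm (x, v)))).2.2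

/-- The bilinear map `B_U (x) = ½ D₂² S_{U,2} (x, 0)` associated with `S` in the chart `e`. -/
noncomputable def sprayBilin (S : TangentBdl E M → TangentBdl₂ E M) (e : atlas E M) (x v w : E) : E :=
  (1 / 2 : ℝ) • iterDirDeriv (sprayCoeff S e x) 2 0 ![v, w]

/-- `K : T(TM) → TM` is the connection map associated with the spray `S`: a smooth vector bundle
morphism over `Π_M : TM → M` that has the form `(x, v, u, w) ↦ (x, w - B_U (x) (v, u))` in the chart
induced by each chart `e : U → E` of `M`. -/
structure IsConnectionMapOf (S : TangentBdl E M → TangentBdl₂ E M)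
    (K : TangentBdl₂ E M → TangentBdl E M) : Prop where
  smooth : SmoothMap ((E × E) × (E × E)) (E × E) K
  base : ∀ ξ, tangentProj E (K ξ) = tangentProj E (tangentProj (E × E) ξ)
  linear : ∀ p : TangentBdl E M, IsLinearMap ℝ fun a : E × E => (K ⟨p, a⟩).vec
  local_form : ∀ (e : atlas E M) (ξ : TangentBdl₂ E M) (x v u w : E),
    ξ ∈ (tangentChart₂ e).1.source → (tangentChart₂ e).1 ξ = ((x, v), (u, w)) →
      (tangentChart e).1 (K ξ) = (x, w - sprayBilin S e x v u)

/-- The vertical subbundle `VTM = ker T Π_M` of `T(TM)`. -/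
def VertBdl (E M : Type*) [AddCommGroup E] [Module ℝ E] [TopologicalSpace E]
    [IsTopologicalAddGroup E] [ContinuousSMul ℝ E] [LocallyConvexSpace ℝ E] [T2Space E]
    [TopologicalSpace M] [ChartedSpace E M] [SmoothManifold E M] :=
  {ξ : TangentBdl₂ E M // (tangentMapProj ξ).vec = 0}

/-- A (smooth, in general nonlinear) connection on `TM`: a smooth left splitting
`C : T(TM) → VTM` of the exact sequence `0 → VTM → T(TM) → Π_M^* TM → 0` of vector bundles
over `TM`. -/
structure IsConnection (C : TangentBdl₂ E M → VertBdl E M) : Prop where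
  smooth : SmoothMap ((E × E) × (E × E)) ((E × E) × (E × E)) fun ξ => (C ξ).1
  base : ∀ ξ, tangentProj (E × E) (C ξ).1 = tangentProj (E × E) ξ
  linear : ∀ p : TangentBdl E M, IsLinearMap ℝ fun a : E × E => (C ⟨p, a⟩).1.vec
  splitting : ∀ ζ : VertBdl E M, C ζ.1 = ζ

/-- Addition in the fibres of `T Π_M : T(TM) → TM`, the secondary vector bundle structure:
`(x, v, u, w) + (x, v', u, w') = (x, v + v', u, w + w')` in charts. Meaningful if
`T Π_M (ξ) = T Π_M (η)`. -/
def secondaryAdd (ξ η : TangentBdl₂ E M) : TangentBdl₂ E M :=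
  ⟨⟨ξ.pt.pt, ξ.pt.vec + η.pt.vec⟩, (ξ.vec.1, ξ.vec.2 + η.vec.2)⟩

/-- Multiplication by `s` in the fibres of `T Π_M : T(TM) → TM`, that is, `(L_s)_*`. -/
noncomputable def secondarySmul (s : ℝ) (ξ : TangentBdl₂ E M) : TangentBdl₂ E M :=
  tangentMapOf (E × E) (E × E) (fun p : TangentBdl E M => s • p) ξ

/-- The canonical involution of `T(TM)`: `(x, v, u, w) ↦ (x, u, v, w)` in charts. -/
def canonicalInv (ξ : TangentBdl₂ E M) : TangentBdl₂ E M :=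
  ⟨⟨ξ.pt.pt, ξ.vec.1⟩, (ξ.pt.vec, ξ.vec.2)⟩

/-- The second projection of `VTM ≃ TM ×_M TM`: the vertical vector `d/dt (v + t w)` at `t = 0`
goes to `w`; in charts, `(x, v, 0, w) ↦ (x, w)`. -/
def vertProj (ζ : VertBdl E M) : TangentBdl E M := ⟨ζ.1.pt.pt, ζ.1.vec.2⟩

/-- A linear symmetric connection on `TM`: a connection `C` that is linear on the fibres of
`T Π_M` also, and whose fibre component is invariant under the canonical involution. -/
structure IsLinearSymmConnection (C : TangentBdl₂ E M → VertBdl E M) : Prop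
    extends IsConnection C where
  secondary_add : ∀ ξ η : TangentBdl₂ E M, tangentMapProj ξ = tangentMapProj η →
    (C (secondaryAdd ξ η)).1 = secondaryAdd (C ξ).1 (C η).1
  secondary_smul : ∀ (s : ℝ) (ξ : TangentBdl₂ E M),
    (C (secondarySmul s ξ)).1 = secondarySmul s (C ξ).1
  symmetric : ∀ ξ, vertProj (C (canonicalInv ξ)) = vertProj (C ξ)

end Manifold
end FrechetGeometry

open FrechetGeometry

namespace FrechetGeometry

section SmoothCalculus

set_option linter.unusedSectionVars false

variable {E F G : Type*}
  [AddCommGroup E] [Module ℝ E] [TopologicalSpace E] [IsTopologicalAddGroup E] [ContinuousSMul ℝ E]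
  [AddCommGroup F] [Module ℝ F] [TopologicalSpace F] [IsTopologicalAddGroup F] [ContinuousSMul ℝ F]
  [LocallyConvexSpace ℝ F] [T2Space F]
  [AddCommGroup G] [Module ℝ G] [TopologicalSpace G] [IsTopologicalAddGroup G] [ContinuousSMul ℝ G]
  [LocallyConvexSpace ℝ G] [T2Space G]

/-! ### Smooth maps: composition -/

/-! A spray and a linear symmetric connection carry the same pointwise datum: at each `x`, a
symmetric bilinear map on the model space. The spray records its diagonal and the connection the map
itself; polarization passes between them.

Fibrewise, a spray is `(x, v) ↦ (x, v, v, f v)` with `f` smooth and `f (s v) = s² f v`.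
Differentiating twice along the line through `v` gives `f v = ½ D² f(0)(v, v)`
(`eq_iterDirDeriv_two_of_homogeneous`), and `D² f(0)` is bilinear and symmetric
(`MBSmoothOn.dirDeriv_comm`). For a connection, fibre linearity and the splitting property force `C
(x, v, u, w) = (x, v, 0, w - β(v, u))` (`IsConnection.eq`). Invariance under the involution makes
`β` symmetric, so `β(v, v)` defines a spray, and polarization recovers `β` from it.

The rest is independence of the chart. With `A` and `Q` the first and second derivatives at `x` of
the change from the preferred chart to `e`, the chart of `T(TM)` is `(x, v, u, w) ↦ (e x, A v, A u,
Q(v, u) + A w)` (`tangentChart₂_apply`). The bilinear map of a spray picks up the same term `Q`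
(`IsSpray.sprayBilin_chart`), so `Q` cancels in `w - B(u, v)` and the formula for the connection
keeps its form in every chart. Smoothness is checked chart by chart, with `B` written through values
of the spray by polarization. -/

theorem MBRec.of_succ {n : ℕ} : ∀ {E : Type*} [AddCommGroup E] [Module ℝ E] [TopologicalSpace E]
    {f : E → F} {U : Set E} (_ : MBRec (n + 1) f U), MBRec n f U := by
  induction n with
  | zero => exact fun H => H.1
  | succ n ih =>
    rintro E _ _ _ f U ⟨h0, f', h1, h2⟩
    exact ⟨h0, f', h1, ih h2⟩

/-- By the chain rule the derivative of the composite is `g'` after `(x, h) ↦ (f x, f' (x, h))`,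
again a composite of the same kind with one derivative fewer. The spaces are quantified inside the
induction because they change to `E × E` and `F × F`. -/
theorem MBRec.comp {n : ℕ} : ∀ {E F : Type*}
    [AddCommGroup E] [Module ℝ E] [TopologicalSpace E] [IsTopologicalAddGroup E]
    [ContinuousSMul ℝ E] [AddCommGroup F] [Module ℝ F] [TopologicalSpace F]
    [IsTopologicalAddGroup F] [ContinuousSMul ℝ F] [LocallyConvexSpace ℝ F] [T2Space F]
    {f : E → F} {g : F → G} {U : Set E} {V : Set F} (_ : IsOpen V) (_ : MapsTo f U V)
    (_ : MBRec n g V) (_ : MBRec n f U), MBRec n (fun x => g (f x)) U := by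
  induction n with
  | zero => exact fun _ hm Hg Hf => ContinuousOn.comp Hg Hf hm
  | succ n ih =>
    intro E F _ _ _ _ _ _ _ _ _ _ _ _ f g U V hV hm Hg Hf
    have Hf' : MBRec n f U := Hf.of_succ
    obtain ⟨g0, g', g1, g2⟩ := Hg
    obtain ⟨f0, f', f1, f2⟩ := Hf
    refine ⟨g0.comp f0 hm, fun p => g' (f p.1, f' p), fun x hx h => ?_, ?_⟩
    · have hO : V ×ˢ (univ : Set F) ∈ 𝓝 (f x, f' (x, h)) :=
        (hV.prod isOpen_univ).mem_nhds ⟨hm hx, trivial⟩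
      refine HasDirDeriv.comp ?_ (g2.continuousOn.continuousAt hO) (f1 x hx h)
      filter_upwards [hO] with p hp using g1 p.1 hp.1 p.2
    · refine ih (V := V ×ˢ univ) (hV.prod isOpen_univ) (fun p hp => ⟨hm hp.1, trivial⟩) g2 ?_
      refine MBRec.prodMk ?_ f2
      exact (Hf'.comp_right (ContinuousLinearMap.fst ℝ E E)).mono fun p hp => hp.1

theorem MBRec.const {n : ℕ} (c : F) : ∀ {E : Type*} [AddCommGroup E] [Module ℝ E]
    [TopologicalSpace E] (U : Set E), MBRec n (fun _ : E => c) U := by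
  induction n generalizing c with
  | zero => exact fun U => continuousOn_const
  | succ n ih =>
    intro E _ _ _ U
    exact ⟨continuousOn_const, fun _ => 0, fun x _ h => by simp [HasDirDeriv], ih 0 _⟩

theorem MBRec.id {n : ℕ} (U : Set F) : MBRec n (fun x : F => x) U := by
  induction n generalizing U with
  | zero => exact continuousOn_id
  | succ n ih =>
    refine ⟨continuousOn_id, fun p => p.2, fun x _ h => ?_,
      ((ih univ).comp_right (ContinuousLinearMap.snd ℝ F F)).mono fun _ _ => trivial⟩
    refine tendsto_const_nhds.congr' ?_
    filter_upwards [self_mem_nhdsWithin] with t ht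
    have ht0 : t ≠ 0 := ht
    simp [smul_smul, ht0]

theorem MBSmoothOn.mbRec {f : E → F} {U : Set E} (hU : IsOpen U) (H : MBSmoothOn f U) (n : ℕ) :
    MBRec n f U := by
  have h := (H.mbRec_iter hU n 0).comp_right
    ((ContinuousLinearMap.id ℝ E).prod (0 : E →L[ℝ] (Fin 0 → E)))
  refine MBRec.mono ?_ h
  exact fun p hp => ⟨hp, trivial⟩

theorem MBSmoothOn.comp {f : E → F} {g : F → G} {U : Set E} {V : Set F} (hU : IsOpen U)
    (hV : IsOpen V) (hm : MapsTo f U V) (Hg : MBSmoothOn g V) (Hf : MBSmoothOn f U) :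
    MBSmoothOn (fun x => g (f x)) U :=
  mbSmoothOn_of_mbRec hU fun n => (Hg.mbRec hV n).comp hV hm (Hf.mbRec hU n)

theorem MBSmoothOn.prodMk {f : E → F} {g : E → G} {U : Set E} (hU : IsOpen U)
    (Hf : MBSmoothOn f U) (Hg : MBSmoothOn g U) : MBSmoothOn (fun x => (f x, g x)) U :=
  mbSmoothOn_of_mbRec hU fun n => (Hf.mbRec hU n).prodMk (Hg.mbRec hU n)

theorem MBSmoothOn.clm_comp {f : E → F} {U : Set E} (hU : IsOpen U) (L : F →L[ℝ] G)
    (Hf : MBSmoothOn f U) : MBSmoothOn (fun x => L (f x)) U :=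
  mbSmoothOn_of_mbRec hU fun n => (Hf.mbRec hU n).comp_left L

theorem mbSmoothOn_const (c : F) {U : Set E} (hU : IsOpen U) : MBSmoothOn (fun _ : E => c) U :=
  mbSmoothOn_of_mbRec hU fun _ => MBRec.const c U

theorem mbSmoothOn_clm [LocallyConvexSpace ℝ E] [T2Space E] (L : E →L[ℝ] F) {U : Set E}
    (hU : IsOpen U) : MBSmoothOn (fun x => L x) U :=
  mbSmoothOn_of_mbRec hU fun _ => (MBRec.id U).comp_left L

theorem mbSmoothOn_id {U : Set F} (hU : IsOpen U) : MBSmoothOn (fun x : F => x) U :=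
  mbSmoothOn_of_mbRec hU fun _ => MBRec.id U

theorem MBSmoothOn.add {f g : E → F} {U : Set E} (hU : IsOpen U)
    (Hf : MBSmoothOn f U) (Hg : MBSmoothOn g U) : MBSmoothOn (fun x => f x + g x) U :=
  mbSmoothOn_of_mbRec hU fun n => (Hf.mbRec hU n).add (Hg.mbRec hU n)

theorem MBSmoothOn.const_smul {f : E → F} {U : Set E} (hU : IsOpen U) (c : ℝ)
    (Hf : MBSmoothOn f U) : MBSmoothOn (fun x => c • f x) U :=
  Hf.clm_comp hU (c • ContinuousLinearMap.id ℝ F)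

theorem MBSmoothOn.sub {f g : E → F} {U : Set E} (hU : IsOpen U)
    (Hf : MBSmoothOn f U) (Hg : MBSmoothOn g U) : MBSmoothOn (fun x => f x - g x) U := by
  simpa [sub_eq_add_neg] using Hf.add hU (Hg.const_smul hU (-1))

theorem MBSmoothOn.mono {f : E → F} {U V : Set E} (hU : IsOpen U) (hV : IsOpen V) (h : V ⊆ U)
    (H : MBSmoothOn f U) : MBSmoothOn f V :=
  mbSmoothOn_of_mbRec hV fun n => (H.mbRec hU n).mono h

/-! ### First and second derivatives -/

theorem MBSmoothOn.dirDeriv_prod {f : E → F} {U : Set E} (hU : IsOpen U) (H : MBSmoothOn f U) :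
    MBSmoothOn (fun p : E × E => dirDeriv f p.1 p.2) (U ×ˢ univ) :=
  ((H.tangent hU).clm_comp (hU.prod isOpen_univ) (ContinuousLinearMap.snd ℝ F F)).congr
    (hU.prod isOpen_univ) fun _ _ => rfl

theorem MBSmoothOn.isLinearMap_dirDeriv {f : E → F} {U : Set E} (hU : IsOpen U)
    (H : MBSmoothOn f U) {x : E} (hx : x ∈ U) : IsLinearMap ℝ (dirDeriv f x) := by
  have key : ∀ (h k : E) (c : ℝ), dirDeriv f x (h + c • k) = dirDeriv f x h + c • dirDeriv f x k := by
    intro h k c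
    exact HasDirDeriv.additive hU (f := f) (f' := fun p => dirDeriv f p.1 p.2)
      (fun y hy h => H.hasDirDeriv hy h)
      (H.dirDeriv_prod hU).continuousOn
      hx h k c
  have h0 : dirDeriv f x 0 = 0 := (HasDirDeriv.zero_dir f x).eq
  exact ⟨fun h k => by simpa using key h k 1, fun c h => by simpa [h0] using key 0 h c⟩

theorem MBSmoothOn.dirDeriv_right {f : E → F} {U : Set E} [LocallyConvexSpace ℝ E] [T2Space E]
    (hU : IsOpen U) (H : MBSmoothOn f U)
    (h : E) : MBSmoothOn (fun y => dirDeriv f y h) U := by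
  have h2 : MBSmoothOn (fun y => (y, h)) U :=
    (mbSmoothOn_id hU).prodMk hU (mbSmoothOn_const h hU)
  have hm : MapsTo (fun y => (y, h)) U (U ×ˢ (univ : Set E)) := fun y hy => ⟨hy, trivial⟩
  exact MBSmoothOn.comp (f := fun y => (y, h)) (g := fun p : E × E => dirDeriv f p.1 p.2) hU
    (hU.prod isOpen_univ) hm (H.dirDeriv_prod hU) h2

theorem iterDirDeriv_two (f : E → F) (x h k : E) :
    iterDirDeriv f 2 x ![h, k] = dirDeriv (fun y => dirDeriv f y h) x k := rfl

/-- The mixed difference quotient with steps `s` along `h` and `t` along `k` is squeezed in two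
ways. Two applications of the mean value principle `diffQuot_mem` keep it in any convex open
neighbourhood of one mixed derivative, while the limits `s → 0` and then `t → 0` lead to the other.
-/
theorem MBSmoothOn.dirDeriv_comm {f : E → F} {U : Set E} [LocallyConvexSpace ℝ E] [T2Space E]
    (hU : IsOpen U) (H : MBSmoothOn f U)
    {x : E} (hx : x ∈ U) (h k : E) :
    dirDeriv (fun y => dirDeriv f y h) x k = dirDeriv (fun y => dirDeriv f y k) x h := by
  have Hh := H.dirDeriv_right hU h
  have Hk := H.dirDeriv_right hU k
  have Hkh := Hk.dirDeriv_right hU h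
  by_contra hne
  -- Two neighbourhoods of one mixed derivative are needed: a closed `C`, which survives limits and
  -- misses the other mixed derivative, and inside it a convex open `V`, to which the mean value
  -- principle applies.
  obtain ⟨C, hCm, hCc, hC⟩ := exists_mem_nhds_isClosed_subset
    (isOpen_compl_singleton.mem_nhds (Ne.symm hne))
  set b := dirDeriv (fun y => dirDeriv f y k) x h with hb
  have hC0 : (fun v => b + v) ⁻¹' C ∈ 𝓝 (0 : F) := by
    apply ContinuousAt.preimage_mem_nhds (by fun_prop)
    simpa using hCm
  obtain ⟨W, ⟨hW0, hWo, hWc⟩, hWC⟩ :=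
    (LocallyConvexSpace.convex_open_basis_zero ℝ F).mem_iff.1 hC0
  set V : Set F := (fun v => -b + v) ⁻¹' W with hV
  have hVo : IsOpen V := hWo.preimage (by fun_prop)
  have hVc : Convex ℝ V := hWc.translate_preimage_right _
  have hVC : V ⊆ C := fun v hv => by simpa using hWC hv
  have hbV : b ∈ V := by simpa [hV] using hW0
  have hN : ∀ᶠ y in 𝓝 x, y ∈ U ∧ dirDeriv (fun y => dirDeriv f y k) y h ∈ V :=
    (hU.eventually_mem hx).and
      ((Hkh.continuousOn.continuousAt (hU.mem_nhds hx)).eventually (hVo.mem_nhds hbV))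
  have hm : ContinuousAt (fun q : ℝ × ℝ => x + q.1 • k + q.2 • h) (0, 0) := by fun_prop
  rw [show x = x + (0 : ℝ) • k + (0 : ℝ) • h by simp] at hN
  have hE := hm.eventually hN
  obtain ⟨δ, hδ, hE⟩ := Metric.eventually_nhds_iff.1 hE
  have hE' : ∀ r s : ℝ, |r| < δ → |s| < δ → x + r • k + s • h ∈ U ∧
      dirDeriv (fun y => dirDeriv f y k) (x + r • k + s • h) h ∈ V := by
    intro r s hr hs
    exact hE (y := (r, s)) (by simpa [Prod.dist_eq] using ⟨hr, hs⟩)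
  have hmul : ∀ r ∈ Icc (0 : ℝ) 1, ∀ t : ℝ, |t| < δ → |r * t| < δ := by
    intro r hr t ht
    rw [abs_mul, abs_of_nonneg hr.1]
    exact (mul_le_of_le_one_left (abs_nonneg t) hr.2).trans_lt ht
  have hdiff : ∀ s t : ℝ, s ≠ 0 → t ≠ 0 → |s| < δ → |t| < δ →
      t⁻¹ • (s⁻¹ • (f (x + t • k + s • h) - f (x + t • k)) - s⁻¹ • (f (x + s • h) - f x)) ∈ V := by
    intro s t hs0 ht0 hs ht
    -- The derivative along `k` of a difference quotient of `f` along `h` is a difference quotient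
    -- along `h` of the `k`-derivative of `f`, so the mean value principle applies again with the
    -- same `V`.
    refine diffQuot_mem (f := fun y => s⁻¹ • (f (y + s • h) - f y)) hVc hVo ht0
      (f' := fun r => s⁻¹ • (dirDeriv f (x + (r * t) • k + s • h) k -
        dirDeriv f (x + (r * t) • k) k)) fun r hr => ⟨?_, ?_⟩
    · have h1 := H.hasDirDeriv (hE' (r * t) s (hmul r hr t ht) hs).1 k
      have h2 := H.hasDirDeriv (by simpa using
        (hE' (r * t) 0 (hmul r hr t ht) (by simpa using hδ)).1) k (x := x + (r * t) • k)
      refine ((h1.sub h2).const_smul s⁻¹).congr fun a => ?_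
      rw [add_right_comm (x + (r * t) • k) (s • h) (a • k)]
      module
    · refine diffQuot_mem (f := fun y => dirDeriv f y k) hVc hVo hs0
        (f' := fun r' => dirDeriv (fun y => dirDeriv f y k) (x + (r * t) • k + (r' * s) • h) h)
        fun r' hr' => ?_
      have := hE' (r * t) (r' * s) (hmul r hr t ht) (hmul r' hr' s hs)
      exact ⟨Hk.hasDirDeriv this.1 h, this.2⟩
  have hsmall : ∀ᶠ t : ℝ in 𝓝[≠] 0, t ≠ 0 ∧ |t| < δ := by
    refine Filter.Eventually.and self_mem_nhdsWithin (nhdsWithin_le_nhds ?_)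
    exact (by simpa [Metric.ball, Real.dist_eq] using Metric.ball_mem_nhds (0 : ℝ) hδ :
      {t : ℝ | |t| < δ} ∈ 𝓝 0)
  have hlim : ∀ᶠ t : ℝ in 𝓝[≠] 0,
      t⁻¹ • (dirDeriv f (x + t • k) h - dirDeriv f x h) ∈ C := by
    filter_upwards [hsmall] with t ⟨ht0, ht⟩
    have h1 := H.hasDirDeriv (by simpa using (hE' t 0 ht (by simpa using hδ)).1) h
      (x := x + t • k)
    have h2 := H.hasDirDeriv hx h
    -- Here `s → 0` with `t` fixed; the limit `t → 0` is taken afterwards.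
    refine hCc.mem_of_tendsto ((h1.sub h2).const_smul t⁻¹) ?_
    filter_upwards [hsmall] with s ⟨hs0, hs⟩ using hVC (hdiff s t hs0 ht0 hs ht)
  exact hC (hCc.mem_of_tendsto (Hh.hasDirDeriv hx k) hlim) rfl

/-! ### Quadratic maps -/

theorem isLinearMap_left_of_symm {T : E → E → F} (hT : ∀ v, IsLinearMap ℝ (T v))
    (hs : ∀ v w, T v w = T w v) (w : E) : IsLinearMap ℝ fun v => T v w := by
  have : (fun v => T v w) = T w := funext fun v => hs v w
  exact this ▸ hT w

theorem polarization {T : E → E → F} (hT : ∀ v, IsLinearMap ℝ (T v))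
    (hs : ∀ v w, T v w = T w v) (v w : E) :
    T v w = (1 / 2 : ℝ) • (T (v + w) (v + w) - T v v - T w w) := by
  have hT' := isLinearMap_left_of_symm hT hs
  rw [(hT (v + w)).map_add, (hT' v).map_add, (hT' w).map_add, hs w v]
  module

theorem symm_bilin_ext {T T' : E → E → F} (hT : ∀ v, IsLinearMap ℝ (T v))
    (hs : ∀ v w, T v w = T w v) (hT' : ∀ v, IsLinearMap ℝ (T' v))
    (hs' : ∀ v w, T' v w = T' w v) (h : ∀ v, T v v = T' v v) (v w : E) : T v w = T' v w := by
  rw [polarization hT hs, polarization hT' hs', h, h, h]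

variable [LocallyConvexSpace ℝ E] [T2Space E]

theorem MBSmoothOn.bilin_two {f : E → F} {U : Set E} (hU : IsOpen U) (H : MBSmoothOn f U)
    {x : E} (hx : x ∈ U) :
    (∀ v, IsLinearMap ℝ fun w => dirDeriv (fun y => dirDeriv f y v) x w) ∧
    (∀ v w, dirDeriv (fun y => dirDeriv f y v) x w = dirDeriv (fun y => dirDeriv f y w) x v) :=
  ⟨fun v => (H.dirDeriv_right hU v).isLinearMap_dirDeriv hU hx, fun v w => H.dirDeriv_comm hU hx v w⟩

/-- Only the line through `v` matters: `f ((t + r) v) - f (t v) = (2 t r + r²) f v`. The derivative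
along `v` at `t v` is therefore `2 t f v`, and the derivative of that at `t = 0` is `2 f v`. -/
theorem eq_iterDirDeriv_two_of_homogeneous {f : E → F}
    (hf : ∀ (s : ℝ) (v : E), f (s • v) = s ^ 2 • f v) (v : E) :
    f v = (1 / 2 : ℝ) • iterDirDeriv f 2 0 ![v, v] := by
  have h1 : ∀ t : ℝ, dirDeriv f (t • v) v = (2 * t) • f v := by
    intro t
    refine HasDirDeriv.eq ?_
    have hc : Tendsto (fun r : ℝ => (2 * t + r) • f v) (𝓝[≠] 0) (𝓝 ((2 * t + 0) • f v)) := by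
      have : ContinuousAt (fun r : ℝ => (2 * t + r) • f v) 0 := by fun_prop
      exact this.tendsto.mono_left nhdsWithin_le_nhds
    rw [add_zero] at hc
    refine hc.congr' ?_
    filter_upwards [self_mem_nhdsWithin] with r hr
    have hr0 : r ≠ 0 := hr
    rw [← add_smul, hf, hf, ← sub_smul, smul_smul]
    congr 1
    field_simp
    ring
  have h2 : dirDeriv (fun y => dirDeriv f y v) 0 v = (2 : ℝ) • f v := by
    refine HasDirDeriv.eq ?_
    refine tendsto_const_nhds.congr' ?_
    filter_upwards [self_mem_nhdsWithin] with r hr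
    have hr0 : r ≠ 0 := hr
    have h0 := h1 0
    simp only [zero_smul, mul_zero] at h0
    rw [zero_add, h1, h0, sub_zero, smul_smul]
    congr 1
    field_simp
  rw [iterDirDeriv_two, h2]
  module

end SmoothCalculus

/-! ### The derivative of a tangent map. -/

section SmoothCalculus

set_option linter.unusedSectionVars false

theorem MBSmoothOn.comp_clm {E E' F : Type*}
    [AddCommGroup E] [Module ℝ E] [TopologicalSpace E] [IsTopologicalAddGroup E]
    [ContinuousSMul ℝ E]
    [AddCommGroup E'] [Module ℝ E'] [TopologicalSpace E'] [IsTopologicalAddGroup E']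
    [ContinuousSMul ℝ E']
    [AddCommGroup F] [Module ℝ F] [TopologicalSpace F] [IsTopologicalAddGroup F]
    [ContinuousSMul ℝ F] [LocallyConvexSpace ℝ F] [T2Space F]
    {f : E → F} {U : Set E} {V : Set E'} (hU : IsOpen U) (hV : IsOpen V)
    (H : MBSmoothOn f U) (L : E' →L[ℝ] E) (hL : MapsTo L V U) :
    MBSmoothOn (fun x => f (L x)) V :=
  mbSmoothOn_of_mbRec hV fun n => ((H.mbRec hU n).comp_right L).mono hL

/-- Linearity splits `D f (x + t u)(v + t w)` as `D f (x + t u) v + t D f (x + t u) w`. The first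
summand contributes the second derivative; the second needs only continuity of `D f`. -/
theorem MBSmoothOn.hasDirDeriv_tangent {E F : Type*}
    [AddCommGroup E] [Module ℝ E] [TopologicalSpace E] [IsTopologicalAddGroup E]
    [ContinuousSMul ℝ E] [LocallyConvexSpace ℝ E] [T2Space E]
    [AddCommGroup F] [Module ℝ F] [TopologicalSpace F] [IsTopologicalAddGroup F]
    [ContinuousSMul ℝ F] [LocallyConvexSpace ℝ F] [T2Space F]
    {f : E → F} {U : Set E} (hU : IsOpen U) (H : MBSmoothOn f U)
    {x : E} (hx : x ∈ U) (v u w : E) :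
    HasDirDeriv (fun p : E × E => (f p.1, dirDeriv f p.1 p.2)) (x, v) (u, w)
      (dirDeriv f x u, dirDeriv (fun y => dirDeriv f y v) x u + dirDeriv f x w) := by
  have h1 := H.hasDirDeriv hx u
  have h2 := (H.dirDeriv_right hU v).hasDirDeriv hx u
  have h3 : Tendsto (fun t : ℝ => dirDeriv f (x + t • u) w) (𝓝[≠] 0) (𝓝 (dirDeriv f x w)) :=
    ((H.dirDeriv_right hU w).continuousOn.continuousAt (hU.mem_nhds hx)).tendsto.comp
      (tendsto_add_smul x u)
  have h4 : Tendsto (fun t : ℝ => t⁻¹ • (dirDeriv f (x + t • u) (v + t • w) - dirDeriv f x v))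
      (𝓝[≠] 0) (𝓝 (dirDeriv (fun y => dirDeriv f y v) x u + dirDeriv f x w)) := by
    refine (h2.add h3).congr' ?_
    filter_upwards [(tendsto_add_smul x u).eventually (hU.mem_nhds hx), self_mem_nhdsWithin]
      with t ht ht0
    have ht0' : t ≠ 0 := ht0
    have hl := H.isLinearMap_dirDeriv hU ht
    rw [hl.map_add, hl.map_smul, add_sub_right_comm, smul_add, smul_smul, inv_mul_cancel₀ ht0',
      one_smul]
  exact h1.prodMk_nhds h4

end SmoothCalculus

/-! ### Smoothness of maps between manifolds, read in charts. -/

section SmoothMaps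

variable {E E' M N : Type*} [AddCommGroup E] [Module ℝ E] [TopologicalSpace E]
  [IsTopologicalAddGroup E] [ContinuousSMul ℝ E] [LocallyConvexSpace ℝ E] [T2Space E]
  [TopologicalSpace M] [ChartedSpace E M] [SmoothManifold E M]
  [AddCommGroup E'] [Module ℝ E'] [TopologicalSpace E']
  [IsTopologicalAddGroup E'] [ContinuousSMul ℝ E'] [LocallyConvexSpace ℝ E'] [T2Space E']
  [TopologicalSpace N] [ChartedSpace E' N] [SmoothManifold E' N]

set_option linter.unusedSectionVars false

theorem SmoothMap.mbSmoothOn {f : M → N} (H : SmoothMap E E' f) (e : atlas E M) (e' : atlas E' N)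
    (h : ∀ y ∈ e.1.source, f y ∈ e'.1.source) :
    MBSmoothOn (e'.1 ∘ f ∘ e.1.symm) e.1.target := by
  have h1 := H.2 e.1 e.2 e'.1 e'.2
  have h2 : e.1.target ∩ e.1.symm ⁻¹' (f ⁻¹' e'.1.source) = e.1.target :=
    inter_eq_left.2 fun y hy => h _ (e.1.map_target hy)
  rwa [h2] at h1

/-- Smoothness of a map can be checked in families of charts whose domains correspond to each other
under the map. -/
theorem smoothMap_of_charts {ι : Type*} (c : ι → atlas E M) (c' : ι → atlas E' N)
    (hc : ∀ e ∈ atlas E M, ∃ i, e = (c i).1) (hc' : ∀ e ∈ atlas E' N, ∃ i, e = (c' i).1)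
    {f : M → N} (hf : ∀ i y, f y ∈ (c' i).1.source ↔ y ∈ (c i).1.source)
    (hs : ∀ i, MBSmoothOn ((c' i).1 ∘ f ∘ (c i).1.symm) (c i).1.target) : SmoothMap E E' f := by
  have hcont : Continuous f := by
    refine continuous_iff_continuousAt.2 fun y => ?_
    obtain ⟨i, hi⟩ := hc _ (chart_mem_atlas E y)
    have hy : y ∈ (c i).1.source := hi ▸ mem_chart_source E y
    have h1 : ContinuousOn ((c' i).1.symm ∘ ((c' i).1 ∘ f ∘ (c i).1.symm) ∘ (c i).1)
        (c i).1.source := by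
      refine (c' i).1.continuousOn_symm.comp
        ((hs i).continuousOn.comp (c i).1.continuousOn fun z hz => (c i).1.map_source hz) ?_
      intro z hz
      simp only [Function.comp_apply, (c i).1.left_inv hz]
      exact (c' i).1.map_source ((hf i z).2 hz)
    have h2 : ContinuousOn f (c i).1.source := by
      refine h1.congr fun z hz => ?_
      simp only [Function.comp_apply, (c i).1.left_inv hz, (c' i).1.left_inv ((hf i z).2 hz)]
    exact h2.continuousAt ((c i).1.open_source.mem_nhds hy)
  refine ⟨hcont, fun e he e' he' => ?_⟩
  obtain ⟨i, rfl⟩ := hc e he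
  obtain ⟨j, rfl⟩ := hc' e' he'
  have hU : IsOpen ((c i).1.target ∩ (c i).1.symm ⁻¹' (f ⁻¹' (c' j).1.source)) :=
    (c i).1.isOpen_inter_preimage_symm ((c' j).1.open_source.preimage hcont)
  have h1 := SmoothManifold.smooth_transition (c' i).1 (c' i).2 (c' j).1 (c' j).2
  have h2 := (hs i).mono (c i).1.open_target hU inter_subset_left
  -- For an unmatched pair of charts the representative factors as the matched one in index `i`
  -- followed by the transition from `c' i` to `c' j`.
  refine (MBSmoothOn.comp (f := (c' i).1 ∘ f ∘ (c i).1.symm) (g := (c' j).1 ∘ (c' i).1.symm) hU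
    (isOpen_transition_source _ _) ?_ h1 h2).congr hU ?_
  · rintro y ⟨hy, hy'⟩
    have h3 : f ((c i).1.symm y) ∈ (c' i).1.source := (hf i _).2 ((c i).1.map_target hy)
    have h4 : f ((c i).1.symm y) ∈ (c' j).1.source := hy'
    simp [h3, h4]
  · rintro y ⟨hy, hy'⟩
    have h3 : f ((c i).1.symm y) ∈ (c' i).1.source := (hf i _).2 ((c i).1.map_target hy)
    simp [h3]

end SmoothMaps

section Manifold

set_option linter.unusedSectionVars false

variable {E M : Type*} [AddCommGroup E] [Module ℝ E] [TopologicalSpace E]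
  [IsTopologicalAddGroup E] [ContinuousSMul ℝ E] [LocallyConvexSpace ℝ E] [T2Space E]
  [TopologicalSpace M] [ChartedSpace E M] [SmoothManifold E M]

/-! ### Charts of the tangent bundle and of the double tangent bundle -/

/-- The preferred chart at `x`, as an element of the atlas. -/
def prefChart (E : Type*) {M : Type*} [TopologicalSpace E] [TopologicalSpace M] [ChartedSpace E M]
    (x : M) : atlas E M := ⟨chartAt E x, chart_mem_atlas E x⟩

/-- The derivative at `x` of the coordinate change from the preferred chart at `x` to `e`. -/
noncomputable def chartDeriv (e : atlas E M) (x : M) (v : E) : E :=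
  dirDeriv (e.1 ∘ (chartAt E x).symm) (chartAt E x x) v

/-- The second derivative at `x` of the coordinate change from the preferred chart at `x` to `e`. -/
noncomputable def chartDeriv₂ (e : atlas E M) (x : M) (v u : E) : E :=
  dirDeriv (fun y => dirDeriv (e.1 ∘ (chartAt E x).symm) y v) (chartAt E x x) u

theorem mem_transition_source (e : atlas E M) {x : M} (hx : x ∈ e.1.source) :
    chartAt E x x ∈ ((prefChart E x).1.symm.trans e.1).source := by
  simp [prefChart, hx]

theorem smooth_transition_prefChart (e : atlas E M) (x : M) :
    MBSmoothOn (e.1 ∘ (chartAt E x).symm) ((prefChart E x).1.symm.trans e.1).source :=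
  SmoothManifold.smooth_transition _ (prefChart E x).2 e.1 e.2

theorem isLinearMap_chartDeriv (e : atlas E M) {x : M} (hx : x ∈ e.1.source) :
    IsLinearMap ℝ (chartDeriv e x) :=
  (smooth_transition_prefChart e x).isLinearMap_dirDeriv (isOpen_transition_source _ _)
    (mem_transition_source e hx)

/-- The reverse coordinate change supplies the inverse. Surjectivity lets arbitrary vectors in a
chart be written as images of vectors in preferred coordinates. -/
theorem chartDeriv_bijective (e : atlas E M) {x : M} (hx : x ∈ e.1.source) :
    Function.Bijective (chartDeriv e x) := by
  have hc := mem_chart_source E x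
  refine Function.bijective_iff_has_inverse.2
    ⟨dirDeriv ((prefChart E x).1 ∘ e.1.symm) (e.1 x), fun v => ?_, fun v => ?_⟩
  · exact (transition_cocycle (prefChart E x) e (prefChart E x) hc hx hc v).trans
      (transition_self (prefChart E x) hc v)
  · exact (transition_cocycle e (prefChart E x) e hx hc hx v).trans (transition_self e hx v)

theorem isLinearMap_chartDeriv₂ (e : atlas E M) {x : M} (hx : x ∈ e.1.source) (v : E) :
    IsLinearMap ℝ (chartDeriv₂ e x v) :=
  ((smooth_transition_prefChart e x).bilin_two (isOpen_transition_source _ _)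
    (mem_transition_source e hx)).1 v

theorem chartDeriv₂_comm (e : atlas E M) {x : M} (hx : x ∈ e.1.source) (v u : E) :
    chartDeriv₂ e x v u = chartDeriv₂ e x u v :=
  ((smooth_transition_prefChart e x).bilin_two (isOpen_transition_source _ _)
    (mem_transition_source e hx)).2 v u

theorem chartDeriv_prefChart (x : M) (v : E) : chartDeriv (prefChart E x) x v = v :=
  transition_self (prefChart E x) (mem_chart_source E x) v

/-- The chart followed from its own inverse is the identity on an open set, so its derivative along
`v` is constantly `v` there. -/
theorem chartDeriv₂_prefChart (x : M) (v u : E) : chartDeriv₂ (prefChart E x) x v u = 0 := by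
  have hU := (chartAt E x).open_target
  have hX := (chartAt E x).map_source (mem_chart_source E x)
  have h0 : HasDirDeriv (fun _ : E => v) (chartAt E x x) u 0 := by simp [HasDirDeriv]
  refine (h0.congr hU (fun y hy => ?_) hX).eq
  exact (dirDeriv_of_eqOn_id hU (fun z hz => (chartAt E x).right_inv hz) hy v).symm

theorem tangentChart_apply (e : atlas E M) (p : TangentBdl E M) :
    (tangentChart e).1 p = (e.1 p.pt, chartDeriv e p.pt p.vec) := rfl

theorem mem_tangentChart₂_source (e : atlas E M) (ξ : TangentBdl₂ E M) :
    ξ ∈ (tangentChart₂ e).1.source ↔ ξ.pt.pt ∈ e.1.source := Iff.rfl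

theorem tangentChart_symm_apply (e : atlas E M) {x : M} (hx : x ∈ e.1.source) (v : E) :
    (tangentChart e).1.symm (e.1 x, chartDeriv e x v) = ⟨x, v⟩ :=
  (tangentChart e).1.left_inv (x := ⟨x, v⟩) hx

theorem tangentChart_prefChart_self (p : TangentBdl E M) :
    (tangentChart (prefChart E p.pt)).1 p = (chartAt E p.pt p.pt, p.vec) := by
  rw [tangentChart_apply, chartDeriv_prefChart]; rfl

/-- The transition of `TM` agrees on an open set with the tangent map of the transition of `M`,
whose derivative is `MBSmoothOn.hasDirDeriv_tangent`. The inhomogeneous term `chartDeriv₂ e x v u`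
is the obstruction that every later chart computation has to cancel. -/
theorem tangentChart₂_apply (e : atlas E M) {x : M} (hx : x ∈ e.1.source) (v u w : E) :
    (tangentChart₂ e).1 (⟨⟨x, v⟩, (u, w)⟩ : TangentBdl₂ E M) = ((e.1 x, chartDeriv e x v),
      (chartDeriv e x u, chartDeriv₂ e x v u + chartDeriv e x w)) := by
  have hO := isOpen_transition_source (prefChart E x).1 e.1
  have h1 := (smooth_transition_prefChart e x).hasDirDeriv_tangent hO
    (mem_transition_source e hx) v u w
  have h2 := h1.congr (hO.prod isOpen_univ)
    (g := (tangentChart e).1 ∘ (tangentChart (prefChart E x)).1.symm)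
    (fun q hq => (tangentPartialEquiv_transition (prefChart E x) e hq).symm)
    ⟨mem_transition_source e hx, trivial⟩
  have h3 : (tangentChart₂ e).1 (⟨⟨x, v⟩, (u, w)⟩ : TangentBdl₂ E M) =
      ((tangentChart e).1 ⟨x, v⟩, dirDeriv ((tangentChart e).1 ∘
        (tangentChart (prefChart E x)).1.symm)
        ((tangentChart (prefChart E x)).1 ⟨x, v⟩) (u, w)) := rfl
  have h4 : (tangentChart (prefChart E x)).1 ⟨x, v⟩ = (chartAt E x x, v) :=
    tangentChart_prefChart_self ⟨x, v⟩
  rw [h3, h4, h2.eq]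
  rfl

/-- In the chart of `TM` induced by the preferred chart, the bundle projection is the first
projection of `E × E`. -/
theorem tangentMapProj_eq (ξ : TangentBdl₂ E M) : tangentMapProj ξ = ⟨ξ.pt.pt, ξ.vec.1⟩ := by
  have hU : IsOpen ((chartAt E ξ.pt.pt).target ×ˢ (univ : Set E)) :=
    (chartAt E ξ.pt.pt).open_target.prod isOpen_univ
  have h1 : HasDirDeriv (fun q : E × E => q.1)
      ((tangentChart (prefChart E ξ.pt.pt)).1 ξ.pt) ξ.vec ξ.vec.1 := by
    refine tendsto_const_nhds.congr' ?_
    filter_upwards [self_mem_nhdsWithin] with t ht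
    have ht0 : t ≠ 0 := ht
    simp [smul_smul, ht0]
  have h2 := h1.congr hU (g := chartAt E ξ.pt.pt ∘ tangentProj E ∘
    (tangentChart (prefChart E ξ.pt.pt)).1.symm) (fun q hq => ?_) ?_
  · ext
    · rfl
    · exact h2.eq
  · exact ((chartAt E ξ.pt.pt).right_inv hq.1).symm
  · exact ⟨(chartAt E ξ.pt.pt).map_source (mem_chart_source E ξ.pt.pt), trivial⟩

theorem secondarySmul_eq (s : ℝ) (ξ : TangentBdl₂ E M) :
    secondarySmul s ξ = ⟨⟨ξ.pt.pt, s • ξ.pt.vec⟩, (ξ.vec.1, s • ξ.vec.2)⟩ := by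
  have hU : IsOpen ((chartAt E ξ.pt.pt).target ×ˢ (univ : Set E)) :=
    (chartAt E ξ.pt.pt).open_target.prod isOpen_univ
  have h1 : HasDirDeriv (fun q : E × E => (q.1, s • q.2))
      ((tangentChart (prefChart E ξ.pt.pt)).1 ξ.pt) ξ.vec (ξ.vec.1, s • ξ.vec.2) := by
    refine tendsto_const_nhds.congr' ?_
    filter_upwards [self_mem_nhdsWithin] with t ht
    have ht0 : t ≠ 0 := ht
    simp [smul_smul, mul_comm s, ht0]
  have h2 := h1.congr hU (g := (tangentChart (prefChart E ξ.pt.pt)).1 ∘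
    (fun p : TangentBdl E M => s • p) ∘ (tangentChart (prefChart E ξ.pt.pt)).1.symm)
    (fun q hq => ?_) ?_
  · ext
    · rfl
    · rfl
    · exact congrArg Prod.fst h2.eq
    · exact congrArg Prod.snd h2.eq
  -- Multiplication by `s` is defined in the preferred chart of each point, and that chart varies
  -- with the point; linearity of `chartDeriv` shows that in one fixed chart it is still `(q₁, q₂) ↦
  -- (q₁, s q₂)`.
  · have hq' : q ∈ (tangentChart (prefChart E ξ.pt.pt)).1.target := hq
    obtain ⟨p, hp, rfl⟩ := (tangentChart (prefChart E ξ.pt.pt)).1.surjOn hq'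
    simp only [Function.comp_apply, (tangentChart (prefChart E ξ.pt.pt)).1.left_inv hp]
    ext
    · rfl
    · exact ((isLinearMap_chartDeriv (prefChart E ξ.pt.pt) hp).map_smul s p.vec).symm
  · exact ⟨(chartAt E ξ.pt.pt).map_source (mem_chart_source E ξ.pt.pt), trivial⟩

theorem exists_eq_tangentChart₂ {e : OpenPartialHomeomorph (TangentBdl₂ E M) ((E × E) × (E × E))}
    (he : e ∈ atlas ((E × E) × (E × E)) (TangentBdl₂ E M)) :
    ∃ e' : atlas E M, e = (tangentChart₂ e').1 := by
  obtain ⟨e₁, rfl⟩ := exists_eq_tangentChart he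
  obtain ⟨e₂, he₂⟩ := exists_eq_tangentChart e₁.2
  exact ⟨e₂, congrArg (fun e => (tangentChart e).1) (Subtype.ext he₂ : e₁ = tangentChart e₂)⟩

/-! ### Sprays in charts -/

/-- The factor `s ^ 2` combines one `s` from the fibre multiple `s • S p` and one from the tangent
map of multiplication by `s`. -/
theorem isSpray_iff (S : TangentBdl E M → TangentBdl₂ E M) :
    IsSpray S ↔ SmoothMap (E × E) ((E × E) × (E × E)) S ∧
      (∀ p, S p = ⟨p, (p.vec, (S p).vec.2)⟩) ∧
      ∀ (s : ℝ) (p : TangentBdl E M), (S (s • p)).vec.2 = s ^ 2 • (S p).vec.2 := by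
  have hform : ((∀ p, tangentProj (E × E) (S p) = p) ∧ ∀ p, tangentMapProj (S p) = p) ↔
      ∀ p, S p = ⟨p, (p.vec, (S p).vec.2)⟩ := by
    refine ⟨fun h p => ?_, fun h => ⟨fun p => ?_, fun p => ?_⟩⟩
    · have h1 : (S p).pt = p := h.1 p
      have h2 := congrArg TangentBdl.vec (tangentMapProj_eq (S p))
      rw [h.2 p] at h2
      exact TangentBdl.ext h1 (Prod.ext h2.symm rfl)
    · rw [h p]; rfl
    · rw [tangentMapProj_eq, h p]
  have hhom : (∀ p, S p = ⟨p, (p.vec, (S p).vec.2)⟩) → ∀ (s : ℝ) (p : TangentBdl E M),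
      (S (s • p) = tangentMapOf (E × E) (E × E) (fun p : TangentBdl E M => s • p) (s • S p) ↔
        (S (s • p)).vec.2 = s ^ 2 • (S p).vec.2) := by
    intro h s p
    have h1 : tangentMapOf (E × E) (E × E) (fun p : TangentBdl E M => s • p) (s • S p) =
        ⟨s • p, (s • p.vec, s ^ 2 • (S p).vec.2)⟩ := by
      refine (secondarySmul_eq s (s • S p)).trans ?_
      rw [h p, sq, mul_smul]
      rfl
    rw [h1, h (s • p)]
    exact ⟨fun h => congrArg (fun ξ => ξ.vec.2) h, fun h => by rw [← h]; rfl⟩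
  constructor
  · intro H
    have h := hform.1 ⟨H.isSection, H.second_order⟩
    exact ⟨H.smooth, h, fun s p => (hhom h s p).1 (H.homogeneous s p)⟩
  · rintro ⟨h1, h2, h3⟩
    exact ⟨h1, (hform.2 h2).1, (hform.2 h2).2, fun s p => (hhom h2 s p).2 (h3 s p)⟩

variable {S : TangentBdl E M → TangentBdl₂ E M}

theorem IsSpray.eq (H : IsSpray S) (p : TangentBdl E M) : S p = ⟨p, (p.vec, (S p).vec.2)⟩ :=
  ((isSpray_iff S).1 H).2.1 p

theorem IsSpray.sprayCoeff_chart (H : IsSpray S) (e : atlas E M) {x : M} (hx : x ∈ e.1.source)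
    (v : E) : sprayCoeff S e (e.1 x) (chartDeriv e x v) =
      chartDeriv₂ e x v v + chartDeriv e x (S ⟨x, v⟩).vec.2 := by
  rw [sprayCoeff, tangentChart_symm_apply e hx, H.eq ⟨x, v⟩, tangentChart₂_apply e hx]

theorem IsSpray.smooth_sprayCoeff (H : IsSpray S) (e : atlas E M) :
    MBSmoothOn (fun q : E × E => sprayCoeff S e q.1 q.2) (e.1.target ×ˢ univ) := by
  have h1 := H.smooth.mbSmoothOn (tangentChart e) (tangentChart₂ e) fun p hp => by
    rw [H.eq]; exact hp
  exact (h1.clm_comp (e.1.open_target.prod isOpen_univ)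
    ((ContinuousLinearMap.snd ℝ E E).comp (ContinuousLinearMap.snd ℝ (E × E) (E × E)))).congr
    (e.1.open_target.prod isOpen_univ) fun _ _ => rfl

theorem IsSpray.sprayCoeff_smul (H : IsSpray S) (e : atlas E M) {x : E} (hx : x ∈ e.1.target)
    (s : ℝ) (v : E) : sprayCoeff S e x (s • v) = s ^ 2 • sprayCoeff S e x v := by
  -- Point and vector are pulled back to preferred coordinates, where homogeneity is known; the
  -- extra term `chartDeriv₂ e y v v` is itself quadratic in `v`.
  obtain ⟨y, hy, rfl⟩ := e.1.surjOn hx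
  obtain ⟨v, rfl⟩ := (chartDeriv_bijective e hy).2 v
  have hA := isLinearMap_chartDeriv e hy
  have hQ := isLinearMap_chartDeriv₂ e hy
  have h1 : (S ⟨y, s • v⟩).vec.2 = s ^ 2 • (S ⟨y, v⟩).vec.2 :=
    ((isSpray_iff S).1 H).2.2 s ⟨y, v⟩
  rw [← hA.map_smul, H.sprayCoeff_chart e hy, H.sprayCoeff_chart e hy, h1, hA.map_smul,
    (hQ _).map_smul, chartDeriv₂_comm e hy, (hQ _).map_smul, smul_smul, smul_add, sq]

theorem IsSpray.smooth_sprayCoeff_right (H : IsSpray S) (e : atlas E M) {x : E}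
    (hx : x ∈ e.1.target) : MBSmoothOn (sprayCoeff S e x) univ := by
  have h1 : MBSmoothOn (fun v : E => (x, v)) univ :=
    (mbSmoothOn_const x isOpen_univ).prodMk isOpen_univ (mbSmoothOn_id isOpen_univ)
  exact MBSmoothOn.comp (f := fun v : E => (x, v)) (g := fun q : E × E => sprayCoeff S e q.1 q.2)
    isOpen_univ (e.1.open_target.prod isOpen_univ) (fun v _ => ⟨hx, trivial⟩)
    (H.smooth_sprayCoeff e) h1

theorem IsSpray.isLinearMap_sprayBilin (H : IsSpray S) (e : atlas E M) {x : E}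
    (hx : x ∈ e.1.target) (v : E) : IsLinearMap ℝ (sprayBilin S e x v) := by
  have h := ((H.smooth_sprayCoeff_right e hx).bilin_two isOpen_univ (mem_univ 0)).1 v
  refine ⟨fun w w' => ?_, fun c w => ?_⟩
  · simp only [sprayBilin, iterDirDeriv_two, h.map_add, smul_add]
  · simp only [sprayBilin, iterDirDeriv_two, h.map_smul, smul_comm c]

theorem IsSpray.sprayBilin_comm (H : IsSpray S) (e : atlas E M) {x : E} (hx : x ∈ e.1.target)
    (v w : E) : sprayBilin S e x v w = sprayBilin S e x w v := by
  simp only [sprayBilin, iterDirDeriv_two]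
  rw [((H.smooth_sprayCoeff_right e hx).bilin_two isOpen_univ (mem_univ 0)).2]

theorem IsSpray.sprayCoeff_eq_sprayBilin (H : IsSpray S) (e : atlas E M) {x : E}
    (hx : x ∈ e.1.target) (v : E) : sprayCoeff S e x v = sprayBilin S e x v v :=
  eq_iterDirDeriv_two_of_homogeneous (fun s v => H.sprayCoeff_smul e hx s v) v

/-- Polarization writes the bilinear map through `sprayCoeff` at `u + v`, `u` and `v`, so joint
smoothness follows without differentiating in a parameter. -/
theorem IsSpray.smooth_sprayBilin (H : IsSpray S) (e : atlas E M) :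
    MBSmoothOn (fun q : (E × E) × (E × E) => sprayBilin S e q.1.1 q.2.1 q.1.2)
      (tangentChart₂ e).1.target := by
  have hU := (e.1.open_target.prod (isOpen_univ (X := E)))
  have hV : IsOpen (tangentChart₂ e).1.target := (tangentChart₂ e).1.open_target
  let x : (E × E) × (E × E) →L[ℝ] E :=
    (ContinuousLinearMap.fst ℝ E E).comp (ContinuousLinearMap.fst ℝ (E × E) (E × E))
  let v : (E × E) × (E × E) →L[ℝ] E :=
    (ContinuousLinearMap.snd ℝ E E).comp (ContinuousLinearMap.fst ℝ (E × E) (E × E))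
  let u : (E × E) × (E × E) →L[ℝ] E :=
    (ContinuousLinearMap.fst ℝ E E).comp (ContinuousLinearMap.snd ℝ (E × E) (E × E))
  have key : ∀ l : (E × E) × (E × E) →L[ℝ] E,
      MBSmoothOn (fun q => sprayCoeff S e (x q) (l q)) (tangentChart₂ e).1.target :=
    fun l => (H.smooth_sprayCoeff e).comp_clm hU hV (x.prod l) fun q hq => ⟨hq.1.1, trivial⟩
  refine ((((key (u + v)).sub hV (key u)).sub hV (key v)).const_smul hV (1 / 2)).congr hV ?_
  intro q hq
  have hx : q.1.1 ∈ e.1.target := hq.1.1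
  rw [polarization (H.isLinearMap_sprayBilin e hx) (H.sprayBilin_comm e hx),
    ← H.sprayCoeff_eq_sprayBilin e hx, ← H.sprayCoeff_eq_sprayBilin e hx,
    ← H.sprayCoeff_eq_sprayBilin e hx]
  rfl

/-- The bilinear map of a spray in the preferred chart at `x`. -/
noncomputable def sprayForm (S : TangentBdl E M → TangentBdl₂ E M) (x : M) (v w : E) : E :=
  sprayBilin S (prefChart E x) (chartAt E x x) v w

theorem chartAt_mem_prefChart_target (x : M) : chartAt E x x ∈ (prefChart E x).1.target :=
  (chartAt E x).map_source (mem_chart_source E x)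

theorem IsSpray.isLinearMap_sprayForm (H : IsSpray S) (x : M) (v : E) :
    IsLinearMap ℝ (sprayForm S x v) :=
  H.isLinearMap_sprayBilin _ (chartAt_mem_prefChart_target x) v

theorem IsSpray.sprayForm_comm (H : IsSpray S) (x : M) (v w : E) :
    sprayForm S x v w = sprayForm S x w v :=
  H.sprayBilin_comm _ (chartAt_mem_prefChart_target x) v w

theorem IsSpray.sprayForm_self (H : IsSpray S) (x : M) (v : E) :
    sprayForm S x v v = (S ⟨x, v⟩).vec.2 := by
  have h := H.sprayCoeff_chart (prefChart E x) (mem_chart_source E x) v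
  rw [chartDeriv_prefChart, chartDeriv₂_prefChart, chartDeriv_prefChart, zero_add] at h
  exact (H.sprayCoeff_eq_sprayBilin _ (chartAt_mem_prefChart_target x) v).symm.trans h

/-- Both sides are symmetric and bilinear in `(v, w)`, so it is enough to compare diagonals, where
this is the transformation law `IsSpray.sprayCoeff_chart`. -/
theorem IsSpray.sprayBilin_chart (H : IsSpray S) (e : atlas E M) {x : M} (hx : x ∈ e.1.source)
    (v w : E) : sprayBilin S e (e.1 x) (chartDeriv e x v) (chartDeriv e x w) =
      chartDeriv₂ e x v w + chartDeriv e x (sprayForm S x v w) := by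
  have hA := isLinearMap_chartDeriv e hx
  have hQ := isLinearMap_chartDeriv₂ e hx
  have hx' := e.1.map_source hx
  have hB := H.isLinearMap_sprayBilin e hx'
  have hF := H.isLinearMap_sprayForm x
  refine symm_bilin_ext
    (T := fun v w => sprayBilin S e (e.1 x) (chartDeriv e x v) (chartDeriv e x w))
    (T' := fun v w => chartDeriv₂ e x v w + chartDeriv e x (sprayForm S x v w))
    (fun v => ⟨fun a b => ?_, fun c a => ?_⟩) (fun v w => H.sprayBilin_comm e hx' _ _)
    (fun v => ⟨fun a b => ?_, fun c a => ?_⟩) (fun v w => ?_) (fun v => ?_) v w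
  · rw [hA.map_add, (hB _).map_add]
  · rw [hA.map_smul, (hB _).map_smul]
  · rw [(hQ v).map_add, (hF v).map_add, hA.map_add]; abel
  · rw [(hQ v).map_smul, (hF v).map_smul, hA.map_smul, smul_add]
  · rw [chartDeriv₂_comm e hx, H.sprayForm_comm]
  · rw [← H.sprayCoeff_eq_sprayBilin e hx', H.sprayCoeff_chart e hx, H.sprayForm_self]

/-! ### The connection of a spray -/

theorem VertBdl.vec_fst (ζ : VertBdl E M) : ζ.1.vec.1 = 0 := by
  have h := ζ.2
  rwa [tangentMapProj_eq] at h

/-- The connection associated with a spray. -/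
noncomputable def sprayConnection (S : TangentBdl E M → TangentBdl₂ E M) (ξ : TangentBdl₂ E M) :
    VertBdl E M :=
  ⟨⟨ξ.pt, (0, ξ.vec.2 - sprayForm S ξ.pt.pt ξ.vec.1 ξ.pt.vec)⟩, by rw [tangentMapProj_eq]⟩

/-- The last coordinate `w` and the bilinear map contain the same second derivative of the
coordinate change, which cancels in the difference. The output is vertical, so it acquires no such
term of its own. -/
theorem IsSpray.sprayConnection_chart (H : IsSpray S) (e : atlas E M) (ξ : TangentBdl₂ E M)
    (x u v w : E) (hξ : ξ ∈ (tangentChart₂ e).1.source)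
    (h : (tangentChart₂ e).1 ξ = ((x, u), (v, w))) :
    (tangentChart₂ e).1 (sprayConnection S ξ).1 = ((x, u), (0, w - sprayBilin S e x v u)) := by
  obtain ⟨⟨y, a⟩, b, c⟩ := ξ
  have hy : y ∈ e.1.source := hξ
  have hA := isLinearMap_chartDeriv e hy
  rw [tangentChart₂_apply e hy] at h
  simp only [Prod.mk.injEq] at h
  obtain ⟨⟨rfl, rfl⟩, rfl, rfl⟩ := h
  refine (tangentChart₂_apply e hy a 0 _).trans ?_
  rw [hA.map_zero, (isLinearMap_chartDeriv₂ e hy a).map_zero, H.sprayBilin_chart e hy,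
    hA.map_sub, chartDeriv₂_comm e hy b a]
  simp only [Prod.mk.injEq, true_and]
  abel

theorem IsSpray.smooth_sprayConnection (H : IsSpray S) :
    SmoothMap ((E × E) × (E × E)) ((E × E) × (E × E)) fun ξ => (sprayConnection S ξ).1 := by
  refine smoothMap_of_charts tangentChart₂ tangentChart₂ (fun e he => exists_eq_tangentChart₂ he)
    (fun e he => exists_eq_tangentChart₂ he) (fun e ξ => Iff.rfl) fun e => ?_
  have hV : IsOpen (tangentChart₂ e).1.target := (tangentChart₂ e).1.open_target
  have h1 : MBSmoothOn (fun q : (E × E) × (E × E) => q.2.2 - sprayBilin S e q.1.1 q.2.1 q.1.2)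
      (tangentChart₂ e).1.target :=
    MBSmoothOn.sub hV (mbSmoothOn_clm
      ((ContinuousLinearMap.snd ℝ E E).comp (ContinuousLinearMap.snd ℝ (E × E) (E × E))) hV)
      (H.smooth_sprayBilin e)
  have h2 : MBSmoothOn (fun q : (E × E) × (E × E) => q.1) (tangentChart₂ e).1.target :=
    mbSmoothOn_clm (ContinuousLinearMap.fst ℝ (E × E) (E × E)) hV
  refine (h2.prodMk hV ((mbSmoothOn_const (0 : E) hV).prodMk hV h1)).congr hV fun q hq => ?_
  exact (H.sprayConnection_chart e ((tangentChart₂ e).1.symm q) q.1.1 q.1.2 q.2.1 q.2.2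
    ((tangentChart₂ e).1.map_target hq) ((tangentChart₂ e).1.right_inv hq)).symm

/-- Each axiom is a property of `sprayForm`: linearity in the first argument gives linearity over
`TM`, its vanishing at `0` gives the splitting, linearity in the second gives the secondary
linearity, and its symmetry gives invariance under the involution. -/
theorem IsSpray.isLinearSymmConnection (H : IsSpray S) :
    IsLinearSymmConnection (sprayConnection S) where
  smooth := H.smooth_sprayConnection
  base ξ := rfl
  linear p := by
    have h := isLinearMap_left_of_symm (H.isLinearMap_sprayForm p.pt) (H.sprayForm_comm p.pt) p.vec
    refine ⟨fun a b => ?_, fun c a => ?_⟩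
    · refine Prod.ext (add_zero 0).symm ?_
      change a.2 + b.2 - sprayForm S p.pt (a.1 + b.1) p.vec =
        (a.2 - sprayForm S p.pt a.1 p.vec) + (b.2 - sprayForm S p.pt b.1 p.vec)
      rw [h.map_add]
      abel
    · refine Prod.ext (smul_zero c).symm ?_
      change c • a.2 - sprayForm S p.pt (c • a.1) p.vec = c • (a.2 - sprayForm S p.pt a.1 p.vec)
      rw [h.map_smul, smul_sub]
  splitting ζ := by
    have h0 := ζ.vec_fst
    have h := isLinearMap_left_of_symm (H.isLinearMap_sprayForm ζ.1.pt.pt)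
      (H.sprayForm_comm ζ.1.pt.pt) ζ.1.pt.vec
    refine Subtype.ext (TangentBdl.ext rfl (Prod.ext h0.symm ?_))
    change ζ.1.vec.2 - sprayForm S ζ.1.pt.pt ζ.1.vec.1 ζ.1.pt.vec = ζ.1.vec.2
    rw [h0, h.map_zero, sub_zero]
  secondary_add ξ η hξη := by
    rw [tangentMapProj_eq, tangentMapProj_eq] at hξη
    obtain ⟨⟨x, v⟩, u, w⟩ := ξ
    obtain ⟨⟨x', v'⟩, u', w'⟩ := η
    simp only [TangentBdl.mk.injEq] at hξη
    obtain ⟨rfl, rfl⟩ := hξη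
    refine TangentBdl.ext rfl (Prod.ext rfl ?_)
    change w + w' - sprayForm S x u (v + v') = (w - sprayForm S x u v) + (w' - sprayForm S x u v')
    rw [(H.isLinearMap_sprayForm x u).map_add]
    abel
  secondary_smul s ξ := by
    rw [secondarySmul_eq, secondarySmul_eq]
    refine TangentBdl.ext rfl (Prod.ext rfl ?_)
    change s • ξ.vec.2 - sprayForm S ξ.pt.pt ξ.vec.1 (s • ξ.pt.vec) =
      s • (ξ.vec.2 - sprayForm S ξ.pt.pt ξ.vec.1 ξ.pt.vec)
    rw [(H.isLinearMap_sprayForm _ _).map_smul, smul_sub]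
  symmetric ξ := by
    refine TangentBdl.ext rfl ?_
    change ξ.vec.2 - sprayForm S ξ.pt.pt ξ.pt.vec ξ.vec.1 =
      ξ.vec.2 - sprayForm S ξ.pt.pt ξ.vec.1 ξ.pt.vec
    rw [H.sprayForm_comm]

/-! ### The spray of a linear symmetric connection -/

variable {C : TangentBdl₂ E M → VertBdl E M}

/-- The bilinear map of a connection at `x`, in the preferred chart at `x`. -/
noncomputable def connForm (C : TangentBdl₂ E M → VertBdl E M) (x : M) (v u : E) : E :=
  -(C ⟨⟨x, v⟩, (u, 0)⟩).1.vec.2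

/-- Decompose `(u, w) = (u, 0) + (0, w)`: the second summand is vertical, hence fixed by `C`, and
the first defines `connForm`. -/
theorem IsConnection.eq (H : IsConnection C) (x : M) (v u w : E) :
    (C ⟨⟨x, v⟩, (u, w)⟩).1 = ⟨⟨x, v⟩, (0, w - connForm C x v u)⟩ := by
  refine TangentBdl.ext (H.base _) (Prod.ext (VertBdl.vec_fst _) ?_)
  have h1 := (H.linear ⟨x, v⟩).map_add (u, 0) (0, w)
  have h2 := H.splitting ⟨⟨⟨x, v⟩, (0, w)⟩, by rw [tangentMapProj_eq]⟩
  simp only [Prod.mk_add_mk, add_zero, zero_add, h2] at h1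
  rw [h1, connForm, sub_neg_eq_add, add_comm]
  rfl

theorem IsConnection.isLinearMap_connForm (H : IsConnection C) (x : M) (v : E) :
    IsLinearMap ℝ (connForm C x v) := by
  have h := H.linear ⟨x, v⟩
  refine ⟨fun a b => ?_, fun c a => ?_⟩
  · have h1 := congrArg Prod.snd (h.map_add (a, 0) (b, 0))
    simp only [Prod.mk_add_mk, add_zero, Prod.snd_add] at h1
    rw [connForm, h1, neg_add]
    rfl
  · have h1 := congrArg Prod.snd (h.map_smul c (a, 0))
    simp only [Prod.smul_mk, smul_zero, Prod.smul_snd] at h1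
    rw [connForm, h1, ← smul_neg]
    rfl

theorem IsLinearSymmConnection.connForm_comm (H : IsLinearSymmConnection C) (x : M) (v u : E) :
    connForm C x v u = connForm C x u v := by
  have h := congrArg TangentBdl.vec (H.symmetric ⟨⟨x, u⟩, (v, 0)⟩)
  exact congrArg Neg.neg h

/-- The spray associated with a connection. -/
noncomputable def connSpray (C : TangentBdl₂ E M → VertBdl E M) (p : TangentBdl E M) :
    TangentBdl₂ E M :=
  ⟨p, (p.vec, connForm C p.pt p.vec p.vec)⟩

/-- This transfers smoothness from `C` to the spray. In the chart `e`, feed `C` the point `(X, V, V,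
0)`; its last preferred coordinate `w` satisfies `A w = -Q(v, v)`, so the output ends in `-(Q(v, v)
+ A β(v, v))`, the negative of the last coordinate of the spray. -/
theorem IsConnection.connSpray_chart (H : IsConnection C) (e : atlas E M) {q : E × E}
    (hq : q ∈ (tangentChart e).1.target) :
    (tangentChart₂ e).1 (connSpray C ((tangentChart e).1.symm q)) =
      (q, (q.2, -((tangentChart₂ e).1 (C ((tangentChart₂ e).1.symm (q, (q.2, 0)))).1).2.2)) := by
  have hq' : (q, (q.2, (0 : E))) ∈ (tangentChart₂ e).1.target := ⟨hq, trivial⟩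
  obtain ⟨⟨⟨x, v⟩, u, w⟩, hξ, h⟩ := (tangentChart₂ e).1.surjOn hq'
  have hx : x ∈ e.1.source := hξ
  have hA := isLinearMap_chartDeriv e hx
  rw [← h, (tangentChart₂ e).1.left_inv hξ]
  rw [tangentChart₂_apply e hx] at h
  obtain ⟨X, V⟩ := q
  simp only [Prod.mk.injEq] at h
  obtain ⟨⟨rfl, rfl⟩, h2, h3⟩ := h
  -- The second and third chart coordinates coincide, hence so do the preferred ones.
  obtain rfl := (chartDeriv_bijective e hx).1 h2
  rw [tangentChart_symm_apply e hx, H.eq, tangentChart₂_apply e hx, hA.map_zero,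
    (isLinearMap_chartDeriv₂ e hx u).map_zero, hA.map_sub]
  refine (tangentChart₂_apply e hx u u _).trans ?_
  rw [eq_neg_of_add_eq_zero_right h3]
  simp only [Prod.mk.injEq, true_and]
  abel

theorem IsConnection.smooth_connSpray (H : IsConnection C) :
    SmoothMap (E × E) ((E × E) × (E × E)) (connSpray C) := by
  refine smoothMap_of_charts tangentChart tangentChart₂ (fun e he => exists_eq_tangentChart he)
    (fun e he => exists_eq_tangentChart₂ he) (fun e p => Iff.rfl) fun e => ?_
  have hU : IsOpen (tangentChart e).1.target := (tangentChart e).1.open_target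
  have hV : IsOpen (tangentChart₂ e).1.target := (tangentChart₂ e).1.open_target
  have hC := H.smooth.mbSmoothOn (tangentChart₂ e) (tangentChart₂ e) fun ξ hξ => by
    have := congrArg TangentBdl.pt (H.base ξ)
    rw [mem_tangentChart₂_source] at hξ ⊢
    exact (this : (C ξ).1.pt.pt = ξ.pt.pt) ▸ hξ
  let L : E × E →L[ℝ] (E × E) × (E × E) :=
    (ContinuousLinearMap.id ℝ (E × E)).prod ((ContinuousLinearMap.snd ℝ E E).prod 0)
  have h1 := (hC.comp_clm hV hU L fun q hq => ⟨hq, trivial⟩).clm_comp hU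
    (-((ContinuousLinearMap.snd ℝ E E).comp (ContinuousLinearMap.snd ℝ (E × E) (E × E))))
  have h2 : MBSmoothOn (fun q : E × E => q.2) (tangentChart e).1.target :=
    mbSmoothOn_clm (ContinuousLinearMap.snd ℝ E E) hU
  exact ((mbSmoothOn_id hU).prodMk hU (h2.prodMk hU h1)).congr hU
    fun q hq => (H.connSpray_chart e hq).symm

theorem IsLinearSymmConnection.isSpray (H : IsLinearSymmConnection C) : IsSpray (connSpray C) := by
  refine (isSpray_iff _).2 ⟨H.smooth_connSpray, fun p => rfl, fun s p => ?_⟩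
  change connForm C p.pt (s • p.vec) (s • p.vec) = s ^ 2 • connForm C p.pt p.vec p.vec
  have h := H.isLinearMap_connForm p.pt
  rw [(h _).map_smul, H.connForm_comm, (h _).map_smul, smul_smul, sq]

/-- The spray retains only the diagonal of `connForm`; symmetry of the connection is what makes the
diagonal determine the whole form. -/
theorem IsLinearSymmConnection.sprayForm_eq (H : IsLinearSymmConnection C) (x : M) (v u : E) :
    sprayForm (connSpray C) x v u = connForm C x v u :=
  symm_bilin_ext (H.isSpray.isLinearMap_sprayForm x) (H.isSpray.sprayForm_comm x)
    (H.isLinearMap_connForm x) (H.connForm_comm x) (fun v => H.isSpray.sprayForm_self x v) v u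

/-- Consequently the local formula proved for the connection of a spray holds for `C` in every
chart. -/
theorem IsLinearSymmConnection.sprayConnection_connSpray (H : IsLinearSymmConnection C) :
    sprayConnection (connSpray C) = C := by
  funext ξ
  obtain ⟨⟨x, v⟩, u, w⟩ := ξ
  refine Subtype.ext ?_
  rw [H.eq, ← H.sprayForm_eq, H.isSpray.sprayForm_comm]
  rfl

/-! ### The second projection of the vertical bundle and the connection map. -/

/-- On vertical vectors the second-derivative term vanishes, so the last coordinate transforms like
a tangent vector at the base point. -/
theorem tangentChart_vertProj (e : atlas E M) (ζ : VertBdl E M)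
    (hζ : ζ.1 ∈ (tangentChart₂ e).1.source) : (tangentChart e).1 (vertProj ζ) =
      (((tangentChart₂ e).1 ζ.1).1.1, ((tangentChart₂ e).1 ζ.1).2.2) := by
  have h0 := ζ.vec_fst
  obtain ⟨⟨⟨x, v⟩, u, w⟩, hv⟩ := ζ
  have hx : x ∈ e.1.source := hζ
  obtain rfl : u = 0 := h0
  rw [tangentChart₂_apply e hx, (isLinearMap_chartDeriv₂ e hx v).map_zero, zero_add]
  rfl

theorem IsConnection.mem_source_iff (H : IsConnection C) (e : atlas E M) (ξ : TangentBdl₂ E M) :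
    (C ξ).1 ∈ (tangentChart₂ e).1.source ↔ ξ ∈ (tangentChart₂ e).1.source := by
  have h : (C ξ).1.pt = ξ.pt := H.base ξ
  rw [mem_tangentChart₂_source, mem_tangentChart₂_source, h]

theorem IsConnection.smooth_vertProj (H : IsConnection C) :
    SmoothMap ((E × E) × (E × E)) (E × E) fun ξ => vertProj (C ξ) := by
  refine smoothMap_of_charts tangentChart₂ tangentChart (fun e he => exists_eq_tangentChart₂ he)
    (fun e he => exists_eq_tangentChart he) (fun e ξ => H.mem_source_iff e ξ) fun e => ?_
  have hV : IsOpen (tangentChart₂ e).1.target := (tangentChart₂ e).1.open_target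
  have hC := H.smooth.mbSmoothOn (tangentChart₂ e) (tangentChart₂ e)
    fun ξ hξ => (H.mem_source_iff e ξ).2 hξ
  refine (hC.clm_comp hV (((ContinuousLinearMap.fst ℝ E E).comp
    (ContinuousLinearMap.fst ℝ (E × E) (E × E))).prod ((ContinuousLinearMap.snd ℝ E E).comp
    (ContinuousLinearMap.snd ℝ (E × E) (E × E))))).congr hV fun q hq => ?_
  exact (tangentChart_vertProj e _
    ((H.mem_source_iff e _).2 ((tangentChart₂ e).1.map_target hq))).symm

theorem IsLinearSymmConnection.isConnectionMapOf (H : IsLinearSymmConnection C) :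
    IsConnectionMapOf (connSpray C) fun ξ => vertProj (C ξ) where
  smooth := H.smooth_vertProj
  base ξ := by
    have h : (C ξ).1.pt = ξ.pt := H.base ξ
    exact (congrArg TangentBdl.pt h : (C ξ).1.pt.pt = ξ.pt.pt)
  linear p := by
    have h := H.linear p
    exact ⟨fun a b => congrArg Prod.snd (h.map_add a b),
      fun c a => congrArg Prod.snd (h.map_smul c a)⟩
  local_form e ξ x v u w hξ h := by
    have h1 := H.isSpray.sprayConnection_chart e ξ x v u w hξ h
    rw [H.sprayConnection_connSpray] at h1
    have hx : x ∈ e.1.target := by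
      have := (tangentChart₂ e).1.map_source hξ
      rw [h] at this
      exact this.1.1
    rw [tangentChart_vertProj e _ ((H.mem_source_iff e ξ).2 hξ), h1,
      H.isSpray.sprayBilin_comm e hx]

theorem tangentChart₂_prefChart_self (x : M) (v u w : E) :
    (tangentChart₂ (prefChart E x)).1 (⟨⟨x, v⟩, (u, w)⟩ : TangentBdl₂ E M) =
      ((chartAt E x x, v), (u, w)) := by
  rw [tangentChart₂_apply _ (mem_chart_source E x)]
  simp only [chartDeriv_prefChart, chartDeriv₂_prefChart, zero_add]
  rfl

/-- A spray is determined by its connection map. -/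
theorem IsSpray.eq_of_isConnectionMapOf {S' : TangentBdl E M → TangentBdl₂ E M}
    {K : TangentBdl₂ E M → TangentBdl E M} (H : IsSpray S) (H' : IsSpray S')
    (h : IsConnectionMapOf S K) (h' : IsConnectionMapOf S' K) : S = S' := by
  funext ⟨x, v⟩
  -- At the test vector `(x, v, v, 0)` the connection map returns `-B(v, v)`, which exposes the
  -- diagonal and with it the spray.
  have hξ : (⟨⟨x, v⟩, (v, 0)⟩ : TangentBdl₂ E M) ∈ (tangentChart₂ (prefChart E x)).1.source :=
    mem_chart_source E x
  have h1 := h.local_form _ _ _ v v 0 hξ (tangentChart₂_prefChart_self x v v 0)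
  have h2 := h'.local_form _ _ _ v v 0 hξ (tangentChart₂_prefChart_self x v v 0)
  have h3 : sprayForm S x v v = sprayForm S' x v v :=
    sub_right_injective (congrArg Prod.snd (h1.symm.trans h2))
  rw [H.sprayForm_self, H'.sprayForm_self] at h3
  rw [H.eq, H'.eq, h3]

end Manifold
end FrechetGeometry

/-! ### The correspondence between sprays and linear symmetric connections. -/

theorem mainTheorem3 (F M : Type*)
    [AddCommGroup F] [Module ℝ F] [UniformSpace F] [IsUniformAddGroup F] [ContinuousSMul ℝ F]
    [LocallyConvexSpace ℝ F] [T2Space F] [FirstCountableTopology F] [CompleteSpace F]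
    [TopologicalSpace M] [ChartedSpace F M] [SmoothManifold F M] :
    (∀ S : TangentBdl F M → TangentBdl₂ F M, IsSpray S →
      (∀ (e : atlas F M), ∀ x ∈ e.1.target,
        (∀ v, IsLinearMap ℝ (sprayBilin S e x v)) ∧
        (∀ v w, sprayBilin S e x v w = sprayBilin S e x w v) ∧
        (∀ v, sprayCoeff S e x v = sprayBilin S e x v v)) ∧
      ∃! C : TangentBdl₂ F M → VertBdl F M, IsLinearSymmConnection C ∧
        ∀ (e : atlas F M) (ξ : TangentBdl₂ F M) (x u v w : F),
          ξ ∈ (tangentChart₂ e).1.source → (tangentChart₂ e).1 ξ = ((x, u), (v, w)) →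
            (tangentChart₂ e).1 (C ξ).1 = ((x, u), (0, w - sprayBilin S e x v u))) ∧
    (∀ C : TangentBdl₂ F M → VertBdl F M, IsLinearSymmConnection C →
      ∃! S : TangentBdl F M → TangentBdl₂ F M,
        IsSpray S ∧ IsConnectionMapOf S (fun ξ => vertProj (C ξ))) := by
  refine ⟨fun S H => ⟨fun e x hx => ⟨H.isLinearMap_sprayBilin e hx, H.sprayBilin_comm e hx,
    H.sprayCoeff_eq_sprayBilin e hx⟩, sprayConnection S,
    ⟨H.isLinearSymmConnection, H.sprayConnection_chart⟩, ?_⟩, fun C H =>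
    ⟨connSpray C, ⟨H.isSpray, H.isConnectionMapOf⟩, fun S' h =>
      h.1.eq_of_isConnectionMapOf H.isSpray h.2 H.isConnectionMapOf⟩⟩
  rintro C ⟨hC, h⟩
  funext ξ
  have hξ : ξ ∈ (tangentChart₂ (prefChart F ξ.pt.pt)).1.source := mem_chart_source F ξ.pt.pt
  -- Both connections keep the base point, so their values at `ξ` lie in the domain of one chart, on
  -- which that chart is injective; the prescribed formula makes the coordinates equal. Since
  -- `sprayConnection` keeps the base point definitionally, `hξ` itself serves for its value.
  refine Subtype.ext ((tangentChart₂ (prefChart F ξ.pt.pt)).1.injOn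
    ((hC.mem_source_iff _ ξ).2 hξ) hξ ?_)
  rw [h _ ξ _ _ _ _ hξ rfl, H.sprayConnection_chart _ ξ _ _ _ _ hξ rfl]
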